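/- For graphs $F$ and $H$, let $R(F,H)$ be the smallest positive integer $N$ such that every red/blue colouring of the edges of the complete graph $K_N$ contains a red copy of $F$ or a blue copy of $H$ (as a not necessarily induced subgraph). Let $C_m$ be the cycle on $m$ vertices, and let $F_n$ be the fan on $2n+1$ vertices, which consists of $n$ triangles that share exactly one common vertex and are otherwise disjoint. Let $a\ge 1/2$ be a fixed real number. Then, as $n\to\infty$, $$R(C_{2\lfloor an\rfloor},F_n)=\begin{cases}(2+2a+o(1))\,n & \text{if } 1/2\le a<1,\\ (4a+o(1))\,n & \text{if } a\ge 1,\end{cases}$$ where $o(1)$ denotes a quantity (which may depend on $a$) that tends to $0$ as $n\to\infty$. -/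

import Mathlib

/-- `N` is a Ramsey bound for `(F, H)`: every red/blue colouring of the edges of the complete graph
on `N` vertices has a red copy of `F` or a blue copy of `H` (copies are not necessarily induced).
A colouring is given by its graph `R` of red edges; the blue edges are then those of `Rᶜ`. -/
def RamseyArrows {V W : Type} (F : SimpleGraph V) (H : SimpleGraph W) (N : ℕ) : Prop :=
  ∀ R : SimpleGraph (Fin N), F.IsContained R ∨ H.IsContained Rᶜ

/-- The Ramsey number `R(F, H)`: the smallest positive integer `N` with `RamseyArrows F H N`. -/
noncomputable def ramseyNumber {V W : Type} (F : SimpleGraph V) (H : SimpleGraph W) : ℕ :=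
  sInf {N : ℕ | 0 < N ∧ RamseyArrows F H N}

/-- The fan `F_n`, on `2n + 1` vertices: `n` triangles that share exactly the vertex `none`.
The `i`-th triangle has vertices `none`, `some (i, false)` and `some (i, true)`. -/
def fanGraph (n : ℕ) : SimpleGraph (Option (Fin n × Bool)) where
  Adj
    | none, none => False
    | none, some _ => True
    | some _, none => True
    | some x, some y => x.1 = y.1 ∧ x.2 ≠ y.2
  symm := ⟨by
    rintro (_ | x) (_ | y) h
    · exact h
    · trivial
    · trivial
    · exact ⟨h.1.symm, h.2.symm⟩⟩
  loopless := ⟨by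
    rintro (_ | x) h
    · exact h
    · exact h.2 rfl⟩

/-!
Let `R` be the red and `B` the blue graph on slightly more than `max (2n + 2m) (4m)` vertices, and
suppose that there is neither a red `C_{2m}` nor a blue `F_n`.

Call a vertex set robust if deleting a few of its vertices never disconnects its red graph. A robust
set of more than `2m` vertices with red degrees greater than `m` contains a red `C_{2m}`: being well
connected, it has a path of almost that length, which is closed up through a hub, a small gadget
of zigzags in a complete bipartite graph whose length and parity can be adjusted.

The blue neighbourhood of a vertex has no blue matching of `n` edges, and the structure of a maximum
matching makes a large part of it almost a red clique. Since almost cliques are robust, blue degrees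
are small, hence red degrees large. Now split the vertex set into parts without red edges between
them, discarding few vertices, until all parts are robust. No part has more than `2m` vertices, so
there are at least three, and a vertex of the smallest part is the centre of a blue `F_n`.

For the lower bound, let the red graph be a disjoint union of two or three cliques of fewer than
`2m` vertices: each edge of a blue triangle joins different cliques, so each blade of a blue fan
meets every clique other than that of its centre.
-/

open SimpleGraph

section Paths

variable {V : Type*} [DecidableEq V] {G : SimpleGraph V} {u v w x y z : V} {X Y : Finset V}

/-- `PathOn G u v X`: some path of `G` from `u` to `v` has vertex set exactly `X`. Recording the
vertex set as a `Finset` makes disjointness and length conditions on several paths easy to state. -/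
inductive PathOn (G : SimpleGraph V) : V → V → Finset V → Prop
  | singleton (u : V) : PathOn G u u {u}
  | cons {u w v : V} {X : Finset V} (huw : G.Adj u w) (hu : u ∉ X) (h : PathOn G w v X) :
      PathOn G u v (insert u X)

namespace PathOn

lemma left_mem (h : PathOn G u v X) : u ∈ X := by
  cases h <;> simp

lemma join (hX : PathOn G u v X) (hvw : G.Adj v w) (hY : PathOn G w x Y) (hXY : Disjoint X Y) :
    PathOn G u x (X ∪ Y) := by
  induction hX with
  | singleton u => exact .cons hvw (Finset.disjoint_singleton_left.1 hXY) hY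
  | cons huw hu _ ih =>
    rw [Finset.disjoint_insert_left] at hXY
    rw [Finset.insert_union]
    exact .cons huw (by simp [hu, hXY.1]) (ih hvw hXY.2)

lemma symm (h : PathOn G u v X) : PathOn G v u X := by
  induction h with
  | singleton u => exact .singleton u
  | @cons u w v X huw hu _ ih =>
    rw [← Finset.union_singleton]
    exact ih.join huw.symm (.singleton u) (Finset.disjoint_singleton_right.2 hu)

lemma right_mem (h : PathOn G u v X) : v ∈ X :=
  h.symm.left_mem

lemma map {W : Type*} [DecidableEq W] {G' : SimpleGraph W} (f : G ↪g G') (h : PathOn G u v X) :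
    PathOn G' (f u) (f v) (X.map f.toEmbedding) := by
  induction h with
  | singleton u => simpa using .singleton (f u)
  | cons huw hu _ ih =>
    rw [Finset.map_insert]
    exact .cons (f.map_adj_iff.2 huw) (by simpa using hu) ih

lemma exists_isPath (h : PathOn G u v X) :
    ∃ p : G.Walk u v, p.IsPath ∧ p.support.toFinset = X := by
  induction h with
  | singleton u => exact ⟨.nil, .nil, by simp⟩
  | cons huw hu _ ih =>
    obtain ⟨p, hp, rfl⟩ := ih
    exact ⟨.cons huw p, hp.cons (by simpa using hu), by simp⟩

lemma cycleGraph_isContained (h : PathOn G u v X) (hvu : G.Adj v u) (hX : 3 ≤ X.card) :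
    cycleGraph X.card ⊑ G := by
  obtain ⟨p, hp, rfl⟩ := h.exists_isPath
  rw [List.toFinset_card_of_nodup hp.support_nodup, Walk.length_support] at hX ⊢
  refine (cycleGraph_isContained_iff hX).2 ⟨v, .cons hvu p, ?_, rfl⟩
  refine (Walk.cons_isCycle_iff p hvu).2 ⟨hp, fun he => ?_⟩
  have := hp.length_eq_one_of_mem_edges (Sym2.eq_swap ▸ he)
  omega

end PathOn

lemma pathOn_of_isPath {p : G.Walk u v} (hp : p.IsPath) :
    PathOn G u v p.support.toFinset := by
  induction p with
  | nil => simpa using .singleton _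
  | cons huw p ih =>
    rw [Walk.cons_isPath_iff] at hp
    rw [Walk.support_cons, List.toFinset_cons]
    exact .cons huw (by simpa using hp.2) (ih hp.1)

/-- `SplitsAt G u v X x y`: the set `X` divides into the vertex sets of a path from `u` to `x` and
of a path from `y` to `v`, where `xy` is an edge; so `xy` is an edge of a path from `u` to `v`. -/
def SplitsAt (G : SimpleGraph V) (u v : V) (X : Finset V) (x y : V) : Prop :=
  G.Adj x y ∧ ∃ Y Z, PathOn G u x Y ∧ PathOn G y v Z ∧ Disjoint Y Z ∧ Y ∪ Z = X

lemma PathOn.splitsAt_insert (h : PathOn G w v X) (huw : G.Adj u w) (hu : u ∉ X) :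
    SplitsAt G u v (insert u X) u w :=
  ⟨huw, {u}, X, .singleton u, h, Finset.disjoint_singleton_left.2 hu, rfl⟩

namespace SplitsAt

lemma cons (h : SplitsAt G w v X x y) (huw : G.Adj u w) (hu : u ∉ X) :
    SplitsAt G u v (insert u X) x y := by
  obtain ⟨hxy, Y, Z, hY, hZ, hYZ, rfl⟩ := h
  rw [Finset.notMem_union] at hu
  exact ⟨hxy, insert u Y, Z, .cons huw hu.1 hY, hZ, Finset.disjoint_insert_left.2 ⟨hu.2, hYZ⟩,
    Finset.insert_union _ _ _⟩

lemma left_mem (h : SplitsAt G u v X x y) : x ∈ X := by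
  obtain ⟨-, Y, Z, hY, -, -, rfl⟩ := h
  exact Finset.mem_union_left _ hY.right_mem

lemma right_mem (h : SplitsAt G u v X x y) : y ∈ X := by
  obtain ⟨-, Y, Z, -, hZ, -, rfl⟩ := h
  exact Finset.mem_union_right _ hZ.left_mem

end SplitsAt

namespace PathOn

lemma exists_splitsAt (h : PathOn G u v X) (hx : x ∈ X) (hxv : x ≠ v) :
    ∃ y, SplitsAt G u v X x y := by
  induction h with
  | singleton u => simp_all
  | @cons u w v X huw hu h ih =>
    obtain rfl | hx := Finset.mem_insert.1 hx
    · exact ⟨w, h.splitsAt_insert huw hu⟩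
    · exact (ih hx hxv).imp fun y hy => hy.cons huw hu

lemma exists_splitsAt_of_even (τ : V → ℕ) (h : PathOn G u v X)
    (hτ : Even (τ u + τ v + X.card)) : ∃ x y, SplitsAt G u v X x y ∧ Even (τ x + τ y) := by
  induction h with
  | singleton u => simp [parity_simps] at hτ
  | @cons u w v X huw hu h ih =>
    by_cases huw' : Even (τ u + τ w)
    · exact ⟨u, w, h.splitsAt_insert huw hu, huw'⟩
    · rw [Finset.card_insert_of_notMem hu] at hτ
      obtain ⟨x, y, hxy, hτxy⟩ := ih (by grind)
      exact ⟨x, y, hxy.cons huw hu, hτxy⟩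

/- The pigeonhole count of the Dirac–Ore argument: shifting `T` along the path makes it meet `S`. -/
lemma exists_splitsAt_of_card_le (h : PathOn G u v X) {S T : Finset V} (hS : S ⊆ X) (hT : T ⊆ X)
    (hu : u ∉ S) (hv : v ∉ T) (hcard : X.card ≤ S.card + T.card) :
    ∃ x y, SplitsAt G u v X x y ∧ x ∈ T ∧ y ∈ S := by
  induction h generalizing S T with
  | singleton u =>
    obtain rfl : S = ∅ := by grind
    obtain rfl : T = ∅ := by grind
    simp at hcard
  | @cons u w v X huw huX h ih =>
    by_cases hcross : u ∈ T ∧ w ∈ S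
    · exact ⟨u, w, h.splitsAt_insert huw huX, hcross⟩
    · rw [Finset.card_insert_of_notMem huX] at hcard
      have hcard' : S.card + T.card ≤ (S.erase w).card + (T.erase u).card + 1 := by
        have hS := Finset.pred_card_le_card_erase (s := S) (a := w)
        have hT := Finset.pred_card_le_card_erase (s := T) (a := u)
        rcases not_and_or.1 hcross with huT | hwS
        · rw [Finset.erase_eq_of_notMem huT]
          omega
        · rw [Finset.erase_eq_of_notMem hwS]
          omega
      obtain ⟨x, y, hxy, hx, hy⟩ := ih (S := S.erase w) (T := T.erase u) (by grind) (by grind)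
        (by simp) (by grind) (by omega)
      exact ⟨x, y, hxy.cons huw huX, Finset.mem_of_mem_erase hx, Finset.mem_of_mem_erase hy⟩

lemma rotate (h : PathOn G u v X) (hvu : G.Adj v u) (hx : x ∈ X) : ∃ y, PathOn G y x X := by
  obtain rfl | hxv := eq_or_ne x v
  · exact ⟨u, h⟩
  · obtain ⟨y, -, Y, Z, hY, hZ, hYZ, rfl⟩ := h.exists_splitsAt hx hxv
    exact ⟨y, Finset.union_comm Y Z ▸ hZ.join hvu hY hYZ.symm⟩

end PathOn

end Paths

section LongPaths

variable {V : Type*} [DecidableEq V] {G : SimpleGraph V} {u v z : V} {X : Finset V}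

lemma PathOn.exists_card_succ_of_adj (h : PathOn G u v X) (hvu : G.Adj v u)
    (hG : G.Preconnected) (hz : z ∉ X) :
    ∃ u' v' X', PathOn G u' v' X' ∧ X'.card = X.card + 1 := by
  obtain ⟨p⟩ := hG u z
  obtain ⟨⟨⟨x, y⟩, hxy⟩, -, hx, hy⟩ := p.exists_boundary_dart X h.left_mem hz
  obtain ⟨w, hw⟩ := h.rotate hvu hx
  have hXy : Disjoint X {y} := Finset.disjoint_singleton_right.2 hy
  exact ⟨w, y, X ∪ {y}, hw.join hxy (.singleton y) hXy, Finset.card_union_of_disjoint hXy⟩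

variable [Fintype V] [DecidableRel G.Adj] {δ : ℕ}

lemma PathOn.exists_card_succ (h : PathOn G u v X) (hG : G.Preconnected)
    (hδ : ∀ w, δ ≤ G.degree w) (hX : X.card ≤ 2 * δ) (hV : X.card < Fintype.card V) :
    ∃ u' v' X', PathOn G u' v' X' ∧ X'.card = X.card + 1 := by
  obtain ⟨z, hz⟩ := Finset.exists_mem_notMem_of_card_lt_card (t := .univ) hV
  by_cases hu : ∃ w ∉ X, G.Adj u w
  · obtain ⟨w, hw, huw⟩ := hu
    exact ⟨w, v, insert w X, .cons huw.symm hw h, Finset.card_insert_of_notMem hw⟩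
  by_cases hv : ∃ w ∉ X, G.Adj v w
  · obtain ⟨w, hw, hvw⟩ := hv
    exact ⟨w, u, insert w X, .cons hvw.symm hw h.symm, Finset.card_insert_of_notMem hw⟩
  push Not at hu hv
  have nbrs_subset {w : V} (hw : ∀ x ∉ X, ¬ G.Adj w x) : G.neighborFinset w ⊆ X := fun x hx =>
    by_contra fun hxX => hw x hxX ((G.mem_neighborFinset w x).1 hx)
  obtain ⟨x, y, ⟨-, Y, Z, hY, hZ, hYZ, rfl⟩, hx, hy⟩ :=
    h.exists_splitsAt_of_card_le (nbrs_subset hu) (nbrs_subset hv) (by simp) (by simp) (by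
      rw [card_neighborFinset_eq_degree, card_neighborFinset_eq_degree]
      linarith [hδ u, hδ v])
  rw [mem_neighborFinset] at hx hy
  exact (hY.join hx.symm hZ.symm hYZ).exists_card_succ_of_adj hy.symm hG hz.2

lemma exists_pathOn_card_eq (hG : G.Preconnected) (hδ : ∀ w, δ ≤ G.degree w)
    (hV : 2 * δ < Fintype.card V) {q : ℕ} (hq : 0 < q) (hqδ : q ≤ 2 * δ + 1) :
    ∃ u v X, PathOn G u v X ∧ X.card = q := by
  induction q, hq using Nat.le_induction with
  | base =>
    obtain ⟨v⟩ : Nonempty V := Fintype.card_pos_iff.1 (by omega)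
    exact ⟨v, v, {v}, .singleton v, Finset.card_singleton v⟩
  | succ q hq ih =>
    obtain ⟨u, v, X, hX, rfl⟩ := ih (by omega)
    exact hX.exists_card_succ hG hδ (by omega) (by omega)

end LongPaths

section ShortPaths

variable {V : Type*} {G : SimpleGraph V} {u v x : V} {δ : ℕ}

lemma dist_getVert_of_length_eq_dist {p : G.Walk u v} (hp : p.length = G.dist u v) {i : ℕ}
    (hi : i ≤ p.length) : G.dist u (p.getVert i) = i := by
  rw [← length_eq_dist_of_subwalk hp (p.isSubwalk_take i), Walk.take_length, min_eq_left hi]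

variable [DecidableRel G.Adj]

lemma card_filter_adj_getVert_le_three {p : G.Walk u v} (hp : p.length = G.dist u v) (x : V) :
    {i ∈ Finset.range p.length | G.Adj (p.getVert i) x}.card ≤ 3 := by
  have hsub : {i ∈ Finset.range p.length | G.Adj (p.getVert i) x} ⊆
      Finset.Icc (G.dist u x - 1) (G.dist u x + 1) := by
    intro i hi
    obtain ⟨hi, hix⟩ := Finset.mem_filter.1 hi
    have hdist := dist_getVert_of_length_eq_dist hp (Finset.mem_range.1 hi).le
    have := hix.diff_dist_adj (u := u)
    rw [Finset.mem_Icc]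
    omega
  have := (Finset.card_le_card hsub).trans_eq (Nat.card_Icc _ _)
  omega

lemma dist_mul_le_three_mul_card [Fintype V] (hδ : ∀ w, δ ≤ G.degree w) (huv : G.Reachable u v) :
    G.dist u v * δ ≤ 3 * Fintype.card V := by
  obtain ⟨p, hp⟩ := huv.exists_walk_length_eq_dist
  rw [← hp, mul_comm 3, ← Finset.card_range p.length, ← Finset.card_univ]
  refine Finset.card_mul_le_card_mul (fun i x => G.Adj (p.getVert i) x) (fun i _ => ?_) fun x _ =>
    card_filter_adj_getVert_le_three hp x
  rw [Finset.bipartiteAbove, ← neighborFinset_eq_filter, card_neighborFinset_eq_degree]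
  exact hδ _

lemma exists_pathOn_card_sub_one_mul_le [Fintype V] [DecidableEq V] (hG : G.Preconnected)
    (hδ : ∀ w, δ ≤ G.degree w) (u v : V) :
    ∃ X, PathOn G u v X ∧ (X.card - 1) * δ ≤ 3 * Fintype.card V := by
  obtain ⟨p, hp, hlen⟩ := (hG u v).exists_path_of_dist
  refine ⟨_, pathOn_of_isPath hp, ?_⟩
  rw [List.toFinset_card_of_nodup hp.support_nodup, Walk.length_support, hlen]
  exact dist_mul_le_three_mul_card hδ (hG u v)

end ShortPaths

section Robust

variable {V : Type*} {G : SimpleGraph V} {k : ℕ} {C D : Finset V}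

/-- The disjoint vertex sets `A` and `B` are *separated* if no edge of `G` joins them. -/
structure IsSeparated (G : SimpleGraph V) (A B : Finset V) : Prop where
  disjoint : Disjoint A B
  not_adj {a b : V} (ha : a ∈ A) (hb : b ∈ B) : ¬ G.Adj a b

/-- The vertex set `C` is *robust*: deleting at most `k` of its vertices never leaves two nonempty
separated parts. -/
def IsRobustOn (G : SimpleGraph V) (k : ℕ) (C : Finset V) : Prop :=
  ∀ A ⊆ C, ∀ B ⊆ C, A.Nonempty → B.Nonempty → IsSeparated G A B → A.card + B.card + k < C.card

lemma IsRobustOn.preconnected_induce (hC : IsRobustOn G k C) (hDC : D ⊆ C)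
    (hcard : C.card ≤ D.card + k) : (G.induce (D : Set V)).Preconnected := by
  classical
  by_contra hG
  simp only [Preconnected, not_forall] at hG
  obtain ⟨u, v, huv⟩ := hG
  let A : Finset D := {x | (G.induce (D : Set V)).Reachable u x}
  have hsub (B : Finset D) : B.map (.subtype _) ⊆ C := (Finset.map_subtype_subset B).trans hDC
  have hlt := hC (A.map (.subtype _)) (hsub A) (Aᶜ.map (.subtype _)) (hsub Aᶜ)
    (Finset.Nonempty.map ⟨u, by simp [A]⟩) (Finset.Nonempty.map ⟨v, by simpa [A] using huv⟩)
    ⟨(Finset.disjoint_map _).2 disjoint_compl_right, fun {a b} ha hb hab => ?_⟩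
  · rw [Finset.card_map, Finset.card_map, Finset.card_add_card_compl, Fintype.card_coe] at hlt
    omega
  · simp only [A, Finset.mem_map, Finset.mem_compl, Finset.mem_filter, Finset.mem_univ, true_and]
      at ha hb
    obtain ⟨x, hx, rfl⟩ := ha
    obtain ⟨y, hy, rfl⟩ := hb
    exact hy (hx.trans (Adj.reachable (G := G.induce (D : Set V)) hab))

lemma IsRobustOn.induce (hC : IsRobustOn G k C) :
    IsRobustOn (G.induce (C : Set V)) k .univ := by
  intro A _ B _ hA hB hAB
  have hlt := hC _ (Finset.map_subtype_subset A) _ (Finset.map_subtype_subset B) hA.map hB.map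
    ⟨(Finset.disjoint_map _).2 hAB.disjoint, fun {a b} ha hb => ?_⟩
  · simpa using hlt
  · obtain ⟨x, hx, rfl⟩ := Finset.mem_map.1 ha
    obtain ⟨y, hy, rfl⟩ := Finset.mem_map.1 hb
    exact hAB.not_adj hx hy

lemma degree_induce_coe [Fintype V] [DecidableEq V] [DecidableRel G.Adj] (D : Finset V) (v : D) :
    (G.induce (D : Set V)).degree v = (G.neighborFinset v ∩ D).card := by
  rw [← card_neighborFinset_eq_degree, ← Finset.card_map (.subtype _)]
  congr 1
  ext w
  simp

lemma degree_le_degree_induce_compl_add_card [Fintype V] [DecidableEq V] [DecidableRel G.Adj]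
    (S : Finset V) (v : (Sᶜ : Finset V)) :
    G.degree v ≤ (G.induce ((Sᶜ : Finset V) : Set V)).degree v + S.card := by
  rw [degree_induce_coe, ← Finset.sdiff_eq_inter_compl, ← card_neighborFinset_eq_degree]
  exact Nat.sub_le_iff_le_add.1 (Finset.le_card_sdiff _ _)

end Robust

section Linked

variable {V : Type*} [DecidableEq V] {G : SimpleGraph V} {k M : ℕ} {H F : Finset V} {t : V → V}

/-- `G` is `(k, M)`-*linked* if, whenever at most `k` vertices are forbidden, any two other vertices
are joined by a path on at most `M` vertices that avoids the forbidden ones. -/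
def IsLinked (G : SimpleGraph V) (k M : ℕ) : Prop :=
  ∀ S : Finset V, S.card ≤ k → ∀ u ∉ S, ∀ v ∉ S, ∃ X, PathOn G u v X ∧ X.card ≤ M ∧ Disjoint X S

lemma IsRobustOn.isLinked [Fintype V] [DecidableRel G.Adj] {Q : ℕ} (hG : IsRobustOn G k .univ)
    (hk : 0 < k) (hV : Fintype.card V ≤ Q * k) (hδ : ∀ v, 2 * k ≤ G.degree v) :
    IsLinked G k (3 * Q + 1) := by
  intro S hS u hu v hv
  have hpre : (G.induce ((Sᶜ : Finset V) : Set V)).Preconnected :=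
    hG.preconnected_induce (Finset.subset_univ _) (by
      rw [Finset.card_univ, ← Finset.card_add_card_compl S]; omega)
  obtain ⟨X, hX, hcard⟩ := exists_pathOn_card_sub_one_mul_le hpre (δ := k) (fun w => by
    have := (hδ w).trans (degree_le_degree_induce_compl_add_card S w)
    omega) ⟨u, by simpa using hu⟩ ⟨v, by simpa using hv⟩
  refine ⟨_, hX.map (Embedding.induce _), ?_, ?_⟩
  · have hle : (X.card - 1) * k ≤ 3 * Q * k := by
      refine hcard.trans ?_
      rw [mul_assoc]
      exact Nat.mul_le_mul_left 3 ((Fintype.card_subtype_le _).trans hV)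
    have := Nat.le_of_mul_le_mul_right hle hk
    rw [Finset.card_map]
    omega
  · rw [Finset.disjoint_left]
    intro x hx
    obtain ⟨⟨y, hy⟩, -, rfl⟩ := Finset.mem_map.1 hx
    simpa using hy

/- Greedy choice; `E i` is the part of the future `i`-th set that the other sets must avoid. -/
lemma exists_pairwiseDisjoint {ι α : Type*} {P : ι → Finset α → Prop} {E : ι → Finset α}
    {I : Finset ι} {M : ℕ} (hM : ∀ i X, P i X → X.card ≤ M)
    (hE : ∀ i ∈ I, ∀ j ∈ I, i ≠ j → ∀ X, P i X → Disjoint (E j) X)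
    (hP : ∀ i ∈ I, ∀ S : Finset α, S.card ≤ I.card * M → Disjoint (E i) S →
      ∃ X, P i X ∧ Disjoint X S) :
    ∃ L : ι → Finset α, (∀ i ∈ I, P i (L i)) ∧ (I : Set ι).PairwiseDisjoint L := by
  classical
  suffices key : ∀ J ⊆ I, ∃ L : ι → Finset α, (∀ i ∈ J, P i (L i)) ∧
      (J : Set ι).PairwiseDisjoint L from key I subset_rfl
  intro J
  induction J using Finset.induction_on with
  | empty => exact fun _ => ⟨fun _ => ∅, by simp, by simp⟩
  | insert i J hi ih =>
    intro hJ
    obtain ⟨hiI, hJ⟩ := Finset.insert_subset_iff.1 hJ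
    obtain ⟨L, hL, hdisj⟩ := ih hJ
    obtain ⟨X, hX, hXL⟩ := hP i hiI (J.biUnion L)
      ((Finset.card_biUnion_le_card_mul _ _ _ fun j hj => hM j _ (hL j hj)).trans
        (Nat.mul_le_mul_right M (Finset.card_le_card hJ)))
      ((Finset.disjoint_biUnion_right _ _ _).2 fun j hj =>
        hE j (hJ hj) i hiI (ne_of_mem_of_not_mem hj hi) _ (hL j hj))
    have hupdate {j : ι} (hj : j ∈ J) : Function.update L i X j = L j :=
      Function.update_of_ne (ne_of_mem_of_not_mem hj hi) _ _
    refine ⟨Function.update L i X, ?_, ?_⟩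
    · rw [Finset.forall_mem_insert, Function.update_self]
      exact ⟨hX, fun j hj => hupdate hj ▸ hL j hj⟩
    · rw [Finset.coe_insert, Set.pairwiseDisjoint_insert_of_notMem (by simpa using hi)]
      refine ⟨fun j hj j' hj' hne => ?_, fun j hj => ?_⟩
      · rw [Function.onFun, hupdate hj, hupdate hj']
        exact hdisj hj hj' hne
      · rw [Function.update_self, hupdate hj]
        exact (Finset.disjoint_biUnion_right _ _ _).1 hXL j hj

lemma IsLinked.exists_linkage (hG : IsLinked G k M) (hHF : H ⊆ F) (htF : ∀ h ∈ H, t h ∈ F)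
    (ht : (H : Set V).InjOn t) (htH : ∀ h ∈ H, t h ∉ H) (hk : F.card + H.card * M ≤ k) :
    ∃ L : V → Finset V, (∀ h ∈ H, PathOn G h (t h) (L h) ∧ (L h).card ≤ M ∧ L h ∩ F ⊆ {h, t h}) ∧
      (H : Set V).PairwiseDisjoint L := by
  refine exists_pairwiseDisjoint (M := M) (E := fun h => {h, t h})
    (P := fun h X => PathOn G h (t h) X ∧ X.card ≤ M ∧ X ∩ F ⊆ {h, t h})
    (fun h X hX => hX.2.1) ?_ ?_
  · rintro h hh h' hh' hne X ⟨-, -, hXF⟩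
    have hnot {x : V} (hx : x ∈ F) (hxh : x ≠ h) (hxt : x ≠ t h) : x ∉ X := fun hxX => by
      simpa [hxh, hxt] using hXF (Finset.mem_inter.2 ⟨hxX, hx⟩)
    rw [Finset.disjoint_insert_left, Finset.disjoint_singleton_left]
    exact ⟨hnot (hHF hh') hne.symm (ne_of_mem_of_not_mem hh' (htH h hh)),
      hnot (htF h' hh') (ne_of_mem_of_not_mem hh (htH h' hh')).symm
        fun heq => hne (ht hh hh' heq.symm)⟩
  · intro h _ S hS hE
    rw [Finset.disjoint_insert_left, Finset.disjoint_singleton_left] at hE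
    obtain ⟨X, hX, hXM, hXS⟩ := hG (F \ {h, t h} ∪ S)
      (((Finset.card_union_le _ _).trans
        (add_le_add (Finset.card_le_card Finset.sdiff_subset) hS)).trans hk)
      h (by simp [hE.1]) (t h) (by simp [hE.2])
    rw [Finset.disjoint_union_right] at hXS
    exact ⟨X, ⟨hX, hXM, by grind [Finset.disjoint_left]⟩, hXS.2⟩

end Linked

section Dominating

variable {V : Type*} [Fintype V] [DecidableEq V] {G : SimpleGraph V} [DecidableRel G.Adj]

/-- The total number of neighbours in `H` that the vertices of `G` miss in order to have `d` each;
the potential that is minimised in the greedy choice of a dominating set. -/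
def deficiency (G : SimpleGraph V) [DecidableRel G.Adj] (d : ℕ) (H : Finset V) : ℕ :=
  ∑ v, (d - (G.neighborFinset v ∩ H).card)

/-- The vertices of `G` with fewer than `d` neighbours in `H`. -/
def deficient (G : SimpleGraph V) [DecidableRel G.Adj] (d : ℕ) (H : Finset V) : Finset V :=
  {v | (G.neighborFinset v ∩ H).card < d}

variable {d k Q : ℕ} {H : Finset V} {h : V}

lemma deficiency_insert_add_card_le (hh : h ∉ H) :
    deficiency G d (insert h H) + ((deficient G d H).bipartiteBelow G.Adj h).card ≤
      deficiency G d H := by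
  rw [Finset.bipartiteBelow, deficient, Finset.filter_filter, Finset.card_filter, deficiency,
    ← Finset.sum_add_distrib]
  refine Finset.sum_le_sum fun v _ => ?_
  split_ifs with hv
  · rw [Finset.inter_insert_of_mem ((G.mem_neighborFinset v h).2 hv.2),
      Finset.card_insert_of_notMem (by simp [hh])]
    omega
  · exact Nat.sub_le_sub_left
      (Finset.card_le_card (Finset.inter_subset_inter_left (Finset.subset_insert h H))) d

lemma le_card_bipartiteAbove_compl_of_mem_deficient {v : V} (hv : v ∈ deficient G d H) :
    G.degree v - d ≤ ((Hᶜ).bipartiteAbove G.Adj v).card := by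
  have hcard : (Hᶜ).bipartiteAbove G.Adj v = G.neighborFinset v \ H := by
    ext; simp [Finset.mem_bipartiteAbove, and_comm]
  have hv := (Finset.mem_filter.1 hv).2
  have := Finset.card_inter_add_card_sdiff (G.neighborFinset v) H
  rw [card_neighborFinset_eq_degree] at this
  rw [hcard]
  omega

lemma exists_card_deficient_le (hQ : 0 < Q) (hk : 0 < k) (hdk : 2 * d ≤ k)
    (hV : Fintype.card V ≤ Q * k) (hδ : ∀ v, k ≤ G.degree v) :
    ∃ H : Finset V, H.card ≤ 4 * d * Q ^ 2 ∧ 2 * (deficient G d H).card ≤ k := by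
  obtain ⟨H, hH⟩ := Finite.exists_min fun H : Finset V => 4 * Q * deficiency G d H + k * H.card
  refine ⟨H, ?_, ?_⟩
  · have hempty := hH ∅
    simp only [deficiency, Finset.inter_empty, Finset.card_empty, Finset.sum_const,
      Finset.card_univ, smul_eq_mul] at hempty
    refine Nat.le_of_mul_le_mul_left (c := k) ?_ hk
    calc k * H.card ≤ 4 * Q * (Fintype.card V * d) := by simpa using le_of_add_le_right hempty
      _ ≤ 4 * Q * (Q * k * d) := by gcongr
      _ = k * (4 * d * Q ^ 2) := by ring
  · have hgain : ∀ h ∈ Hᶜ, ((deficient G d H).bipartiteBelow G.Adj h).card ≤ k / (4 * Q) := by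
      intro h hh
      have hhH := Finset.mem_compl.1 hh
      have hmin := hH (insert h H)
      rw [Finset.card_insert_of_notMem hhH] at hmin
      rw [Nat.le_div_iff_mul_le (by positivity)]
      nlinarith [deficiency_insert_add_card_le (G := G) (d := d) hhH]
    have hcount := Finset.card_mul_le_card_mul G.Adj (m := k - d)
      (fun v hv => (Nat.sub_le_sub_right (hδ v) d).trans
        (le_card_bipartiteAbove_compl_of_mem_deficient hv)) hgain
    have hHV : (Hᶜ).card ≤ Q * k := (Finset.card_le_univ _).trans hV
    have hdiv := Nat.div_mul_le_self k (4 * Q)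
    refine Nat.le_of_mul_le_mul_right (c := k) ?_ hk
    calc 2 * (deficient G d H).card * k
        ≤ 2 * (deficient G d H).card * (2 * (k - d)) := by gcongr; omega
      _ = 4 * ((deficient G d H).card * (k - d)) := by ring
      _ ≤ 4 * (Q * k * (k / (4 * Q))) := Nat.mul_le_mul_left 4 (hcount.trans (by gcongr))
      _ = k * (k / (4 * Q) * (4 * Q)) := by ring
      _ ≤ k * k := by gcongr

end Dominating

section CompleteBipartite

variable {V : Type*} {G : SimpleGraph V}

lemma exists_isCompleteBetween_of_isContained {s : ℕ} (h : completeEquipartiteGraph 2 s ⊑ G) :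
    ∃ A B : Finset V, A.card = s ∧ B.card = s ∧ G.IsCompleteBetween A B := by
  obtain ⟨f⟩ := h
  let part (i : Fin 2) : Finset V := Finset.univ.map ⟨fun j => f (i, j), fun _ _ hj => by
    simpa using f.injective hj⟩
  refine ⟨part 0, part 1, by simp [part], by simp [part], ?_⟩
  simp only [IsCompleteBetween, part, Finset.mem_coe, Finset.mem_map, Finset.mem_univ, true_and]
  rintro _ ⟨i, rfl⟩ _ ⟨j, rfl⟩
  exact f.toHom.map_adj (completeEquipartiteGraph_adj.2 Fin.zero_ne_one)

lemma eventually_completeEquipartiteGraph_two_isContained {ε : ℝ} (hε : 0 < ε) (s : ℕ) :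
    ∀ᶠ n : ℕ in Filter.atTop, ∀ {V : Type*} [Fintype V] [DecidableEq V] {G : SimpleGraph V}
      [DecidableRel G.Adj], Fintype.card V = n → ε * n ≤ G.minDegree →
      completeEquipartiteGraph 2 s ⊑ G := by
  filter_upwards [eventually_completeEquipartiteGraph_isContained_of_minDegree hε 1 s]
    with n hn V _ _ G _ hV hδ
  classical
  refine (isContained_congr_right (G.overFinIso hV)).2 (hn ?_)
  rw [← (G.overFinIso hV).minDegree_eq]
  simpa using hδ

lemma eventually_exists_isCompleteBetween_disjoint (Q s : ℕ) :
    ∀ᶠ k : ℕ in Filter.atTop, ∀ {V : Type*} [Fintype V] [Nonempty V] [DecidableEq V]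
      {G : SimpleGraph V} [DecidableRel G.Adj], Fintype.card V ≤ Q * k →
      (∀ v, 2 * k ≤ G.degree v) → ∀ F : Finset V, F.card ≤ k →
      ∃ A B : Finset V, Disjoint A F ∧ Disjoint B F ∧ A.card = s ∧ B.card = s ∧
        G.IsCompleteBetween A B := by
  obtain ⟨n₀, hn₀⟩ := Filter.eventually_atTop.1
    (eventually_completeEquipartiteGraph_two_isContained (ε := 1 / (Q + 1)) (by positivity) s)
  filter_upwards [Filter.eventually_ge_atTop n₀, Filter.eventually_gt_atTop 0]
    with k hk hk₀ V _ _ _ G _ hV hδ F hF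
  have hFc : k ≤ Fintype.card (Fᶜ : Finset V) := by
    obtain ⟨v⟩ := ‹Nonempty V›
    have := (hδ v).trans_lt (G.degree_lt_card_verts v)
    rw [← Finset.card_add_card_compl F] at this
    rw [Fintype.card_coe]
    omega
  have hmin : k ≤ (G.induce ((Fᶜ : Finset V) : Set V)).minDegree := by
    have : Nonempty (Fᶜ : Finset V) := Fintype.card_pos_iff.1 (hk₀.trans_le hFc)
    refine le_minDegree_of_forall_le_degree _ _ fun v => ?_
    have := (hδ v).trans (degree_le_degree_induce_compl_add_card F v)
    omega
  have hcontained := hn₀ _ (hk.trans hFc) (G := G.induce ((Fᶜ : Finset V) : Set V)) rfl (by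
    rw [div_mul_eq_mul_div, one_mul, div_le_iff₀ (by positivity)]
    have hle : Fintype.card (Fᶜ : Finset V) ≤ Q * k := (Fintype.card_subtype_le _).trans hV
    exact_mod_cast show Fintype.card (Fᶜ : Finset V) ≤ _ * (Q + 1) by nlinarith)
  obtain ⟨A, B, hA, hB, hAB⟩ := exists_isCompleteBetween_of_isContained hcontained
  refine ⟨A.map (.subtype _), B.map (.subtype _), ?_, ?_, by simpa, by simpa, ?_⟩
  · exact disjoint_compl_left.mono_left (Finset.map_subtype_subset A)
  · exact disjoint_compl_left.mono_left (Finset.map_subtype_subset B)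
  · intro x hx y hy
    obtain ⟨a, ha, rfl⟩ := Finset.mem_map.1 hx
    obtain ⟨b, hb, rfl⟩ := Finset.mem_map.1 hy
    exact hAB ha hb

end CompleteBipartite

section Hub

variable {V : Type*} [DecidableEq V] {G : SimpleGraph V} {M m : ℕ} {P : Finset V}
  {u v x y b h₀ h₁ : V}

lemma exists_pathOn_of_isCompleteBetween {A B : Finset V} {j : ℕ}
    (hAB : G.IsCompleteBetween A B) (hA : j ≤ A.card) (hB : j < B.card) :
    ∃ b ∈ B, ∃ b' ∈ B, ∃ X ⊆ A ∪ B, PathOn G b b' X ∧ X.card = 2 * j + 1 := by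
  induction j generalizing A B with
  | zero =>
    obtain ⟨b, hb⟩ := Finset.card_pos.1 hB
    exact ⟨b, hb, b, hb, {b}, by simp [hb], .singleton b, rfl⟩
  | succ j ih =>
    obtain ⟨b, hb⟩ := Finset.card_pos.1 (Nat.zero_lt_of_lt hB)
    obtain ⟨a, ha⟩ := Finset.card_pos.1 (Nat.zero_lt_of_lt hA)
    obtain ⟨c, hc, c', hc', X, hXAB, hX, hcard⟩ := ih (A := A.erase a) (B := B.erase b)
      (fun x hx y hy => hAB (Finset.mem_of_mem_erase hx) (Finset.mem_of_mem_erase hy))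
      (by rw [Finset.card_erase_of_mem ha]; omega) (by rw [Finset.card_erase_of_mem hb]; omega)
    have hdisj : Disjoint A B := Finset.disjoint_coe.1 hAB.disjoint
    have haX : a ∉ X := by grind [Finset.disjoint_left]
    have hbX : b ∉ insert a X := by grind [Finset.disjoint_left]
    exact ⟨b, hb, c', Finset.mem_of_mem_erase hc', insert b (insert a X), by grind,
      .cons (hAB ha hb).symm hbX (.cons (hAB ha (Finset.mem_of_mem_erase hc)) haX hX),
      by rw [Finset.card_insert_of_notMem hbX, Finset.card_insert_of_notMem haX]; omega⟩

/-- A *hub* of width `M`: a complete bipartite graph between `A` and `B`, together with short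
disjoint paths `L h` from the entry vertices `h ∈ H` to terminals `t h` adjacent to all of `B`.
A path with one neighbour in `H` at each end closes through the hub to cycles of many lengths. -/
structure Hub (G : SimpleGraph V) (M : ℕ) where
  H : Finset V
  A : Finset V
  B : Finset V
  t : V → V
  L : V → Finset V
  pathOn {h : V} (hh : h ∈ H) : PathOn G h (t h) (L h)
  card_le {h : V} (hh : h ∈ H) : (L h).card ≤ M
  pairwiseDisjoint : (H : Set V).PairwiseDisjoint L
  disjoint {h : V} (hh : h ∈ H) : Disjoint (L h) (A ∪ B)
  adj_terminal {h : V} (hh : h ∈ H) : ∀ b ∈ B, G.Adj (t h) b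
  isCompleteBetween : G.IsCompleteBetween A B
  le_card_A : 2 * M + 8 ≤ A.card
  le_card_B : 2 * M + 8 ≤ B.card

namespace Hub

/-- All vertices of the hub. -/
def support (Z : Hub G M) : Finset V :=
  Z.H.biUnion Z.L ∪ (Z.A ∪ Z.B)

lemma disjoint_support_iff (Z : Hub G M) :
    Disjoint P Z.support ↔ (∀ h ∈ Z.H, Disjoint P (Z.L h)) ∧ Disjoint P (Z.A ∪ Z.B) := by
  rw [support, Finset.disjoint_union_right, Finset.disjoint_biUnion_right]

lemma cycleGraph_isContained_of_odd (Z : Hub G M) (hP : PathOn G u v P) (hh₀ : h₀ ∈ Z.H)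
    (hh₁ : h₁ ∈ Z.H) (hne : h₀ ≠ h₁) (hu : G.Adj u h₀) (hv : G.Adj v h₁)
    (hPL₀ : Disjoint P (Z.L h₀)) (hPL₁ : Disjoint P (Z.L h₁))
    (hPAB : Disjoint P ((Z.A ∪ Z.B).erase b))
    (hodd : Odd (P.card + (Z.L h₀).card + (Z.L h₁).card))
    (hlow : P.card + (Z.L h₀).card + (Z.L h₁).card ≤ 2 * m)
    (hhigh : 2 * m ≤ P.card + (Z.L h₀).card + (Z.L h₁).card + 4 * M + 10) :
    cycleGraph (2 * m) ⊑ G := by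
  obtain ⟨j, hj⟩ : ∃ j, P.card + (Z.L h₀).card + (Z.L h₁).card + (2 * j + 1) = 2 * m := by
    obtain ⟨i, hi⟩ := hodd
    exact ⟨m - i - 1, by omega⟩
  obtain ⟨c, hc, c', hc', X, hXAB, hX, hcard⟩ := exists_pathOn_of_isCompleteBetween (j := j)
    (A := Z.A.erase b) (B := Z.B.erase b)
    (fun x hx y hy => Z.isCompleteBetween (Finset.mem_of_mem_erase hx) (Finset.mem_of_mem_erase hy))
    (by grind [Z.le_card_A, Finset.pred_card_le_card_erase (s := Z.A) (a := b)])
    (by grind [Z.le_card_B, Finset.pred_card_le_card_erase (s := Z.B) (a := b)])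
  rw [← Finset.erase_union_distrib] at hXAB
  have hLX {h : V} (hh : h ∈ Z.H) : Disjoint (Z.L h) X :=
    (Z.disjoint hh).mono_right (hXAB.trans (Finset.erase_subset _ _))
  have hPX : Disjoint P X := hPAB.mono_right hXAB
  have hL₁L₀ : Disjoint (Z.L h₁) (Z.L h₀) := Z.pairwiseDisjoint hh₁ hh₀ hne.symm
  have hXL₀ : Disjoint X (Z.L h₀) := (hLX hh₀).symm
  have hL₁ : Disjoint (Z.L h₁) (X ∪ Z.L h₀) := Finset.disjoint_union_right.2 ⟨hLX hh₁, hL₁L₀⟩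
  have hPL : Disjoint P (Z.L h₁ ∪ (X ∪ Z.L h₀)) := by
    simp only [Finset.disjoint_union_right]
    exact ⟨hPL₁, hPX, hPL₀⟩
  have hpath := hP.join hv ((Z.pathOn hh₁).join (Z.adj_terminal hh₁ c (Finset.mem_of_mem_erase hc))
    (hX.join (Z.adj_terminal hh₀ c' (Finset.mem_of_mem_erase hc')).symm (Z.pathOn hh₀).symm hXL₀)
    hL₁) hPL
  have hpathcard : (P ∪ (Z.L h₁ ∪ (X ∪ Z.L h₀))).card = 2 * m := by
    rw [Finset.card_union_of_disjoint hPL, Finset.card_union_of_disjoint hL₁,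
      Finset.card_union_of_disjoint hXL₀]
    omega
  have hL₀pos := Finset.card_pos.2 ⟨_, (Z.pathOn hh₀).left_mem⟩
  have hL₁pos := Finset.card_pos.2 ⟨_, (Z.pathOn hh₁).left_mem⟩
  have hPpos := Finset.card_pos.2 ⟨_, hP.left_mem⟩
  exact hpathcard ▸ hpath.cycleGraph_isContained hu.symm (by omega)

lemma pathOn_of_splitsAt (Z : Hub G M) (hPZ : Disjoint P Z.support) (hxy : SplitsAt G u v P x y)
    (hh₀ : h₀ ∈ Z.H) (hh₁ : h₁ ∈ Z.H) (hne : h₀ ≠ h₁) (hx : G.Adj x h₀) (hy : G.Adj y h₁)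
    (hb : b ∈ Z.B) :
    PathOn G u v (P ∪ insert b (Z.L h₀ ∪ Z.L h₁)) ∧
      (P ∪ insert b (Z.L h₀ ∪ Z.L h₁)).card = P.card + (Z.L h₀).card + (Z.L h₁).card + 1 := by
  obtain ⟨-, Y, Y', hY, hY', hYY', rfl⟩ := hxy
  obtain ⟨hPL, hPAB⟩ := Z.disjoint_support_iff.1 hPZ
  have hbL {h : V} (hh : h ∈ Z.H) : b ∉ Z.L h := fun hbh =>
    Finset.disjoint_left.1 (Z.disjoint hh) hbh (Finset.mem_union_right _ hb)
  have hbP : b ∉ Y ∪ Y' := fun hbP => Finset.disjoint_left.1 hPAB hbP (Finset.mem_union_right _ hb)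
  have hL := Z.pairwiseDisjoint hh₀ hh₁ hne
  have hL₁Y' : Disjoint (Z.L h₁) Y' := (Finset.disjoint_union_left.1 (hPL h₁ hh₁)).2.symm
  have hb₁ : b ∉ Z.L h₁ ∪ Y' := by grind
  have hdisj₀ : Disjoint (Z.L h₀) (insert b (Z.L h₁ ∪ Y')) := by
    rw [Finset.disjoint_insert_right, Finset.disjoint_union_right]
    exact ⟨hbL hh₀, hL, (Finset.disjoint_union_left.1 (hPL h₀ hh₀)).2.symm⟩
  have hdisjY : Disjoint Y (Z.L h₀ ∪ insert b (Z.L h₁ ∪ Y')) := by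
    rw [Finset.disjoint_union_right, Finset.disjoint_insert_right, Finset.disjoint_union_right]
    exact ⟨(Finset.disjoint_union_left.1 (hPL h₀ hh₀)).1, fun hbY => hbP (by simp [hbY]),
      (Finset.disjoint_union_left.1 (hPL h₁ hh₁)).1, hYY'⟩
  have hpath := hY.join hx ((Z.pathOn hh₀).join (Z.adj_terminal hh₀ b hb)
    (.cons (Z.adj_terminal hh₁ b hb).symm hb₁ ((Z.pathOn hh₁).symm.join hy.symm hY' hL₁Y'))
    hdisj₀) hdisjY
  have hset : Y ∪ Y' ∪ insert b (Z.L h₀ ∪ Z.L h₁) =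
      Y ∪ (Z.L h₀ ∪ insert b (Z.L h₁ ∪ Y')) := by grind
  refine ⟨hset ▸ hpath, ?_⟩
  rw [hset, Finset.card_union_of_disjoint hdisjY, Finset.card_union_of_disjoint hdisj₀,
    Finset.card_insert_of_notMem hb₁, Finset.card_union_of_disjoint hL₁Y',
    Finset.card_union_of_disjoint hYY']
  omega

lemma exists_entry_of_parity [Fintype V] [DecidableRel G.Adj] (Z : Hub G M)
    (hx : 7 ≤ (G.neighborFinset x ∩ Z.H).card) :
    ∃ r : ℕ, ∀ S : Finset V, S.card < 4 →
      ∃ h ∈ Z.H, h ∉ S ∧ G.Adj x h ∧ Even ((Z.L h).card + r) := by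
  have hsplit := Finset.card_filter_add_card_filter_not (s := G.neighborFinset x ∩ Z.H)
    (fun h => Even (Z.L h).card)
  obtain ⟨r, hr⟩ : ∃ r, 4 ≤ ((G.neighborFinset x ∩ Z.H).filter
      fun h => Even ((Z.L h).card + r)).card := by
    by_cases heven : 4 ≤ ((G.neighborFinset x ∩ Z.H).filter fun h => Even (Z.L h).card).card
    · exact ⟨0, heven⟩
    · refine ⟨1, ?_⟩
      simp only [Nat.even_add_one]
      omega
  refine ⟨r, fun S hS => ?_⟩
  obtain ⟨h, hh, hhS⟩ := Finset.exists_mem_notMem_of_card_lt_card (hS.trans_le hr)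
  simp only [Finset.mem_filter, Finset.mem_inter, mem_neighborFinset] at hh
  exact ⟨h, hh.1.2, hhS, hh.1.1, hh.2⟩

lemma cycleGraph_isContained [Fintype V] [DecidableRel G.Adj] (Z : Hub G M) (hP : PathOn G u v P)
    (hcard : P.card + (4 * M + 10) = 2 * m) (hPZ : Disjoint P Z.support)
    (hdeg : ∀ x ∈ P, 7 ≤ (G.neighborFinset x ∩ Z.H).card) :
    cycleGraph (2 * m) ⊑ G := by
  obtain ⟨hPL, hPAB⟩ := Z.disjoint_support_iff.1 hPZ
  choose! τ hτ using fun x hx => Z.exists_entry_of_parity (hdeg x hx)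
  obtain ⟨h₀, hh₀, -, hu, hτu⟩ := hτ u hP.left_mem ∅ (by simp)
  obtain ⟨h₁, hh₁, hS₁, hv, hτv⟩ := hτ v hP.right_mem {h₀} (by simp)
  have hL₀ := Z.card_le hh₀
  have hL₁ := Z.card_le hh₁
  have hne : h₀ ≠ h₁ := by grind
  obtain ⟨b, hb⟩ := Finset.card_pos.1 (show 0 < Z.B.card by have := Z.le_card_B; omega)
  -- If the parity of the path is wrong, a detour through the hub between consecutive vertices `x`
  -- and `y` with `τ x + τ y` even corrects it.
  rcases Nat.even_or_odd (τ u + τ v + P.card) with heven | hodd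
  · obtain ⟨x, y, hxy, hτxy⟩ := hP.exists_splitsAt_of_even τ heven
    obtain ⟨h₂, hh₂, hS₂, hx, hτx⟩ := hτ x hxy.left_mem {h₀, h₁}
      (Finset.card_le_two.trans_lt (by omega))
    obtain ⟨h₃, hh₃, hS₃, hy, hτy⟩ := hτ y hxy.right_mem {h₀, h₁, h₂}
      (Finset.card_le_three.trans_lt (by omega))
    have hL₂ := Z.card_le hh₂
    have hL₃ := Z.card_le hh₃
    obtain ⟨hpath, hpathcard⟩ := Z.pathOn_of_splitsAt hPZ hxy hh₂ hh₃ (by grind) hx hy hb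
    have hdisj {h : V} (hh : h ∈ Z.H) (hne₂ : h₂ ≠ h) (hne₃ : h₃ ≠ h) :
        Disjoint (P ∪ insert b (Z.L h₂ ∪ Z.L h₃)) (Z.L h) := by
      simp only [Finset.disjoint_union_left, Finset.disjoint_insert_left]
      exact ⟨hPL h hh, fun hbh => Finset.disjoint_left.1 (Z.disjoint hh) hbh (by simp [hb]),
        Z.pairwiseDisjoint hh₂ hh hne₂, Z.pairwiseDisjoint hh₃ hh hne₃⟩
    refine Z.cycleGraph_isContained_of_odd (b := b) hpath hh₀ hh₁ hne hu hv
      (hdisj hh₀ (by grind) (by grind)) (hdisj hh₁ (by grind) (by grind)) ?_ (by grind) (by omega)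
      (by omega)
    have herase := Finset.erase_subset b (Z.A ∪ Z.B)
    simp only [Finset.disjoint_union_left, Finset.disjoint_insert_left]
    exact ⟨hPAB.mono_right herase, Finset.notMem_erase _ _, (Z.disjoint hh₂).mono_right herase,
      (Z.disjoint hh₃).mono_right herase⟩
  · exact Z.cycleGraph_isContained_of_odd (b := b) hP hh₀ hh₁ hne hu hv (hPL h₀ hh₀) (hPL h₁ hh₁)
      (hPAB.mono_right (Finset.erase_subset _ _)) (by grind) (by omega) (by omega)

end Hub

lemma IsLinked.exists_hub {H A B : Finset V} {k : ℕ} (hG : IsLinked G k M)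
    (hAB : G.IsCompleteBetween A B) (hAH : Disjoint A H) (hBH : Disjoint B H)
    (hA : H.card + (2 * M + 8) ≤ A.card) (hB : 2 * M + 8 ≤ B.card)
    (hk : (H ∪ (A ∪ B)).card + H.card * M ≤ k) :
    ∃ Z : Hub G M, Z.H = H ∧ Z.support.card ≤ H.card * M + (A.card + B.card) := by
  obtain ⟨T, hTA, hT⟩ := Finset.exists_subset_card_eq (Nat.le_of_add_right_le hA)
  have : Nonempty V := (Finset.card_pos.1 (by omega : 0 < A.card)).nonempty
  obtain ⟨t, ht⟩ : ∃ t : V → V, Set.BijOn t H T :=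
    H.finite_toSet.exists_bijOn_of_encard_eq (by simp [hT])
  have htA {h : V} (hh : h ∈ H) : t h ∈ A := hTA (ht.mapsTo hh)
  obtain ⟨L, hL, hLdisj⟩ := hG.exists_linkage (F := H ∪ (A ∪ B)) Finset.subset_union_left
    (fun h hh => by simp [htA hh]) ht.injOn
    (fun h hh => Finset.disjoint_left.1 hAH (htA hh)) hk
  refine ⟨{ H := H, A := A \ T, B := B, t := t, L := L
            pathOn := fun hh => (hL _ hh).1
            card_le := fun hh => (hL _ hh).2.1
            pairwiseDisjoint := hLdisj
            disjoint := ?_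
            adj_terminal := fun hh b hb => hAB (htA hh) hb
            isCompleteBetween := fun x hx y hy => hAB (Finset.mem_sdiff.1 hx).1 hy
            le_card_A := by rw [Finset.card_sdiff_of_subset hTA]; omega
            le_card_B := hB }, rfl, ?_⟩
  · intro h hh
    have hLF := (hL h hh).2.2
    have htT : t h ∈ T := ht.mapsTo hh
    have hdisj : Disjoint A B := Finset.disjoint_coe.1 hAB.disjoint
    refine Finset.disjoint_left.2 fun x hxL hxAB => ?_
    have hx : x ∈ ({h, t h} : Finset V) := hLF (by grind)
    clear hL hLdisj hLF
    grind [Finset.disjoint_left]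
  · refine (Finset.card_union_le _ _).trans (Nat.add_le_add ?_ ?_)
    · exact Finset.card_biUnion_le_card_mul _ _ _ fun h hh => (hL h hh).2.1
    · exact (Finset.card_union_le _ _).trans
        (Nat.add_le_add_right (Finset.card_le_card Finset.sdiff_subset) _)

lemma eventually_exists_hub (Q : ℕ) :
    ∀ᶠ k : ℕ in Filter.atTop, ∀ {V : Type*} [Fintype V] [Nonempty V] [DecidableEq V]
      {G : SimpleGraph V} [DecidableRel G.Adj], Fintype.card V ≤ Q * k →
      (∀ v, 2 * k ≤ G.degree v) → IsRobustOn G k .univ →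
      ∃ (Z : Hub G (3 * Q + 1)) (S : Finset V), S.card ≤ k ∧ Z.support ⊆ S ∧
        ∀ x ∉ S, 7 ≤ (G.neighborFinset x ∩ Z.H).card := by
  generalize hM : 3 * Q + 1 = M
  set s := 28 * Q ^ 2 + (2 * M + 8)
  filter_upwards [eventually_exists_isCompleteBetween_disjoint Q s,
    Filter.eventually_ge_atTop (2 * (28 * Q ^ 2 + 2 * s + 28 * Q ^ 2 * M) + 14)]
    with k hbipartite hk V _ _ _ G _ hV hδ hG
  have hQ : 0 < Q := Nat.pos_of_mul_pos_right (Fintype.card_pos.trans_le hV)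
  obtain ⟨H, hH, hdeficient⟩ := exists_card_deficient_le (d := 7) (G := G) hQ (by omega)
    (by omega) hV fun v => by have := hδ v; omega
  obtain ⟨A, B, hAH, hBH, hA, hB, hAB⟩ := hbipartite hV hδ H (by omega)
  have hHM : H.card * M ≤ 28 * Q ^ 2 * M := Nat.mul_le_mul_right _ hH
  have hHAB : (H ∪ (A ∪ B)).card ≤ H.card + (A.card + B.card) :=
    (Finset.card_union_le _ _).trans (Nat.add_le_add_left (Finset.card_union_le _ _) _)
  obtain ⟨Z, rfl, hZ⟩ := (hM ▸ hG.isLinked (by omega) hV hδ).exists_hub hAB hAH hBH (by omega)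
    (by omega) (by omega)
  refine ⟨Z, Z.support ∪ deficient G 7 Z.H, ?_, Finset.subset_union_left, fun x hx => ?_⟩
  · have := Finset.card_union_le Z.support (deficient G 7 Z.H)
    omega
  · simp only [deficient, Finset.mem_union, Finset.mem_filter_univ, not_or, not_lt] at hx
    exact hx.2

theorem eventually_cycleGraph_even_isContained (Q : ℕ) :
    ∀ᶠ k : ℕ in Filter.atTop, ∀ {V : Type*} [Fintype V] {G : SimpleGraph V}
      [DecidableRel G.Adj] {m : ℕ}, k ≤ m → Fintype.card V ≤ Q * k →
      2 * m + 2 * k ≤ Fintype.card V → (∀ v, m + 2 * k ≤ G.degree v) → IsRobustOn G k .univ →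
      cycleGraph (2 * m) ⊑ G := by
  classical
  filter_upwards [eventually_exists_hub Q, Filter.eventually_ge_atTop (6 * Q + 8)]
    with k hhub hk V _ G _ m hkm hV hmV hδ hG
  have : Nonempty V := Fintype.card_pos_iff.1 (by omega)
  obtain ⟨Z, S, hS, hZS, hdeg⟩ := hhub hV (fun v => by have := hδ v; omega) hG
  have hcompl : S.card + Sᶜ.card = Fintype.card V := Finset.card_add_card_compl S
  -- The missing `4M + 10` vertices, `M = 3Q + 1`, are supplied by the hub: up to four linking paths
  -- and a zigzag between `A` and `B` of the length that is still needed.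
  obtain ⟨u, v, P, hP, hPcard⟩ := exists_pathOn_card_eq (q := 2 * m - (4 * (3 * Q + 1) + 10))
    (hG.preconnected_induce (Finset.subset_univ Sᶜ) (by rw [Finset.card_univ]; omega))
    (δ := m) (fun w => by
      have := (hδ w).trans (degree_le_degree_induce_compl_add_card S w); omega)
    (lt_of_lt_of_eq (by omega) (Fintype.card_coe _).symm) (by omega) (by omega)
  have hPS : P.map (.subtype _) ⊆ Sᶜ := Finset.map_subtype_subset P
  refine Z.cycleGraph_isContained (hP.map (Embedding.induce _)) ?_ ?_ fun x hx => hdeg x ?_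
  · rw [Finset.card_map, hPcard]; omega
  · exact Finset.disjoint_left.2 fun x hx hxZ => Finset.mem_compl.1 (hPS hx) (hZS hxZ)
  · exact Finset.mem_compl.1 (hPS hx)

theorem eventually_cycleGraph_even_isContained_of_isRobustOn (Q : ℕ) :
    ∀ᶠ k : ℕ in Filter.atTop, ∀ {V : Type*} [Fintype V] [DecidableEq V] {G : SimpleGraph V}
      [DecidableRel G.Adj] {m : ℕ} {C : Finset V}, k ≤ m → C.card ≤ Q * k → 2 * m + 2 * k ≤ C.card →
      (∀ v ∈ C, m + 2 * k ≤ (G.neighborFinset v ∩ C).card) → IsRobustOn G k C →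
      cycleGraph (2 * m) ⊑ G := by
  filter_upwards [eventually_cycleGraph_even_isContained Q] with k hk V _ _ G _ m C hkm hC hmC hδ hG
  rw [← Fintype.card_coe C] at hC hmC
  exact (hk hkm hC hmC (fun v => (hδ v v.2).trans_eq (degree_induce_coe C v).symm)
    hG.induce).trans ⟨(Embedding.induce _).toCopy⟩

end Hub

section Matching

variable {V : Type*} [DecidableEq V] {G : SimpleGraph V} {Y : Finset V} {M : Finset (V × V)} {n : ℕ}

/-- A matching of `G` inside `Y`, each of its edges given with an orientation. -/
structure IsMatchingOn (G : SimpleGraph V) (Y : Finset V) (M : Finset (V × V)) : Prop where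
  adj {p : V × V} (hp : p ∈ M) : G.Adj p.1 p.2
  subset {p : V × V} (hp : p ∈ M) : {p.1, p.2} ⊆ Y
  pairwiseDisjoint : (M : Set (V × V)).PairwiseDisjoint fun p => ({p.1, p.2} : Finset V)

/-- The vertices covered by the edges of a matching. -/
def covered (M : Finset (V × V)) : Finset V :=
  M.biUnion fun p => {p.1, p.2}

lemma covered_insert (p : V × V) : covered (insert p M) = {p.1, p.2} ∪ covered M :=
  Finset.biUnion_insert

lemma pair_subset_covered {p : V × V} (hp : p ∈ M) : {p.1, p.2} ⊆ covered M :=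
  Finset.subset_biUnion_of_mem (fun p : V × V => ({p.1, p.2} : Finset V)) hp

lemma card_insert_of_notMem_covered {x y : V} (hx : x ∉ covered M) :
    (insert (x, y) M).card = M.card + 1 :=
  Finset.card_insert_of_notMem fun hxy => hx (pair_subset_covered hxy (by simp))

namespace IsMatchingOn

lemma mono {M' : Finset (V × V)} (hM : IsMatchingOn G Y M) (hM' : M' ⊆ M) : IsMatchingOn G Y M' :=
  ⟨fun hp => hM.adj (hM' hp), fun hp => hM.subset (hM' hp), hM.pairwiseDisjoint.subset hM'⟩

lemma covered_subset (hM : IsMatchingOn G Y M) : covered M ⊆ Y :=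
  Finset.biUnion_subset.2 fun _ hp => hM.subset hp

lemma card_covered (hM : IsMatchingOn G Y M) : (covered M).card = 2 * M.card := by
  rw [covered, Finset.card_biUnion hM.pairwiseDisjoint,
    Finset.sum_congr rfl fun p hp => Finset.card_pair (hM.adj hp).ne, Finset.sum_const,
    smul_eq_mul, mul_comm]

protected lemma insert {x y : V} (hM : IsMatchingOn G Y M) (hx : x ∈ Y \ covered M)
    (hy : y ∈ Y \ covered M) (hxy : G.Adj x y) : IsMatchingOn G Y (insert (x, y) M) := by
  rw [Finset.mem_sdiff] at hx hy
  refine ⟨?_, ?_, ?_⟩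
  · simpa [or_imp, forall_and, hxy] using fun a b hab => hM.adj hab
  · simpa [or_imp, forall_and, Finset.insert_subset_iff, hx.1, hy.1] using
      fun a b hab => hM.subset hab
  · rw [Finset.coe_insert, Set.pairwiseDisjoint_insert]
    refine ⟨hM.pairwiseDisjoint, fun p hp _ => ?_⟩
    have hpM := pair_subset_covered hp
    rw [Finset.disjoint_left]
    grind

lemma sdiff_covered_erase (hM : IsMatchingOn G Y M) {p : V × V} (hp : p ∈ M) :
    Y \ covered (M.erase p) = Y \ covered M ∪ {p.1, p.2} := by
  have hpY := hM.subset hp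
  have hcovered : covered M = {p.1, p.2} ∪ covered (M.erase p) := by
    rw [← covered_insert, Finset.insert_erase hp]
  have hdisj : Disjoint ({p.1, p.2} : Finset V) (covered (M.erase p)) :=
    (Finset.disjoint_biUnion_right _ _ _).2 fun q hq =>
      hM.pairwiseDisjoint hp (Finset.mem_of_mem_erase hq) (Finset.ne_of_mem_erase hq).symm
  rw [Finset.disjoint_left] at hdisj
  grind

lemma exists_card_eq_add_one_of_augmenting (hM : IsMatchingOn G Y M) {p : V × V} (hp : p ∈ M)
    {x y : V} (hx : x ∈ Y \ covered M) (hy : y ∈ Y \ covered M) (hxy : x ≠ y)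
    (hpx : G.Adj p.1 x) (hpy : G.Adj p.2 y) :
    ∃ M', IsMatchingOn G Y M' ∧ M'.card = M.card + 1 := by
  have hpM := pair_subset_covered hp
  have hsdiff := hM.sdiff_covered_erase hp
  have hp₁₂ : p.1 ≠ p.2 := (hM.adj hp).ne
  have hx₂ : p.2 ≠ x := by grind
  have hy₁ : y ≠ p.1 := by grind
  obtain ⟨hp₁, hx₁, hp₂, hy₂⟩ : p.1 ∈ Y \ covered (M.erase p) ∧ x ∈ Y \ covered (M.erase p) ∧
      p.2 ∈ Y \ covered (M.erase p) ∧ y ∈ Y \ covered (M.erase p) := by grind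
  have hM' := (hM.mono (Finset.erase_subset p M)).insert hp₁ hx₁ hpx
  rw [Finset.mem_sdiff] at hp₁ hp₂ hy₂
  have hp₂' : p.2 ∉ covered (insert (p.1, x) (M.erase p)) := by
    simp [covered_insert, hp₁₂.symm, hx₂, hp₂.2]
  have hy₂' : y ∉ covered (insert (p.1, x) (M.erase p)) := by
    simp [covered_insert, hy₁, hxy.symm, hy₂.2]
  refine ⟨_, hM'.insert (Finset.mem_sdiff.2 ⟨hp₂.1, hp₂'⟩) (Finset.mem_sdiff.2 ⟨hy₂.1, hy₂'⟩) hpy,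
    ?_⟩
  rw [card_insert_of_notMem_covered hp₂', card_insert_of_notMem_covered hp₁.2,
    Finset.card_erase_add_one hp]

lemma fanGraph_isContained (hM : IsMatchingOn G Y M) {v : V} (hv : ∀ y ∈ Y, G.Adj v y) :
    fanGraph M.card ⊑ G := by
  let e : Fin M.card → V × V := fun i => M.equivFin.symm i
  let g : Fin M.card × Bool → V := fun p => if p.2 then (e p.1).2 else (e p.1).1
  have he (i : Fin M.card) : e i ∈ M := (M.equivFin.symm i).2
  have hge (p : Fin M.card × Bool) : g p ∈ ({(e p.1).1, (e p.1).2} : Finset V) := by grind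
  have hgY (p : Fin M.card × Bool) : G.Adj v (g p) := hv _ (hM.subset (he p.1) (hge p))
  have hginj : Function.Injective g := by
    rintro ⟨i, b⟩ ⟨j, c⟩ hij
    have hmem : g (i, b) ∈ ({(e j).1, (e j).2} : Finset V) := hij ▸ hge (j, c)
    obtain rfl : i = j := M.equivFin.symm.injective <| Subtype.ext <|
      hM.pairwiseDisjoint.elim_finset (he i) (he j) _ (hge (i, b)) hmem
    have := (hM.adj (he i)).ne
    grind
  refine ⟨⟨⟨fun o => o.elim v g, ?_⟩, ?_⟩⟩
  · rintro (_ | ⟨i, b⟩) (_ | ⟨j, c⟩) h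
    · exact h.elim
    · exact hgY _
    · exact (hgY _).symm
    · obtain ⟨rfl, hbc⟩ : i = j ∧ b ≠ c := h
      have hadj := hM.adj (he i)
      have hadj' := hadj.symm
      cases b <;> cases c <;> grind
  · rintro (_ | p) (_ | q) h
    · rfl
    · exact absurd h (hgY q).ne
    · exact absurd h.symm (hgY p).ne
    · exact congrArg some (hginj h)

end IsMatchingOn

end Matching

section NearClique

variable {V : Type*} [DecidableEq V] {G : SimpleGraph V} {U W Y D : Finset V} {n k : ℕ}

/-- `U` is a clique, and every vertex of the disjoint set `W` is adjacent to all vertices of `U`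
with at most one exception. -/
structure IsNearClique (G : SimpleGraph V) (U W : Finset V) : Prop where
  disjoint : Disjoint U W
  isClique : G.IsClique U
  subsingleton_not_adj {w : V} (hw : w ∈ W) : {u | u ∈ U ∧ ¬ G.Adj w u}.Subsingleton

namespace IsNearClique

lemma subsingleton_not_adj_of_mem_union (h : IsNearClique G U W) {v : V} (hv : v ∈ U ∪ W) :
    {u | u ∈ U ∧ ¬ G.Adj v u}.Subsingleton := by
  obtain hv | hv := Finset.mem_union.1 hv
  · refine (Set.subsingleton_singleton (a := v)).anti fun u hu => ?_
    by_contra hne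
    exact hu.2 (h.isClique hv hu.1 (Ne.symm hne))
  · exact h.subsingleton_not_adj hv

lemma card_inter_le_one (h : IsNearClique G U W) {v : V} (hv : v ∈ U ∪ W)
    (hD : ∀ u ∈ D, ¬ G.Adj v u) : (D ∩ U).card ≤ 1 :=
  Finset.card_le_one.2 fun x hx y hy => by
    rw [Finset.mem_inter] at hx hy
    exact h.subsingleton_not_adj_of_mem_union hv ⟨hx.2, hD x hx.1⟩ ⟨hy.2, hD y hy.1⟩

lemma card_sub_one_le [Fintype V] [DecidableRel G.Adj] (h : IsNearClique G U W) {v : V}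
    (hv : v ∈ U ∪ W) : U.card - 1 ≤ (G.neighborFinset v ∩ (U ∪ W)).card := by
  have hnot := h.card_inter_le_one (D := U \ G.neighborFinset v) hv (by simp)
  have hsub : U ⊆ (U \ G.neighborFinset v) ∩ U ∪ G.neighborFinset v ∩ (U ∪ W) := by grind
  have := (Finset.card_le_card hsub).trans (Finset.card_union_le _ _)
  omega

lemma isRobustOn (h : IsNearClique G U W) (hU : k + 3 ≤ U.card) : IsRobustOn G k (U ∪ W) := by
  rintro A hA B hB ⟨a, ha⟩ ⟨b, hb⟩ hAB
  have hAU := h.card_inter_le_one (D := A) (hB hb) fun a ha hba =>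
    hAB.not_adj ha hb hba.symm
  have hBU := h.card_inter_le_one (D := B) (hA ha) fun b hb => hAB.not_adj ha hb
  have hsub : A ∪ B ⊆ A ∩ U ∪ B ∩ U ∪ W := by grind
  have hle := (Finset.card_le_card hsub).trans (Finset.card_union_le _ _)
  have := Finset.card_union_le (A ∩ U) (B ∩ U)
  rw [Finset.card_union_of_disjoint hAB.disjoint] at hle
  rw [Finset.card_union_of_disjoint h.disjoint]
  omega

lemma union_subset_of_closed (h : IsNearClique G U W) (hY : U ∪ W ⊆ Y) (hU : 2 ≤ U.card)
    (hD : ∀ x ∈ D, ∀ y ∈ Y, G.Adj x y → y ∈ D) {u : V} (hu : u ∈ U) (huD : u ∈ D) :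
    U ∪ W ⊆ D := by
  have hUD : U ⊆ D := fun x hx => by
    obtain rfl | hne := eq_or_ne u x
    · exact huD
    · exact hD u huD x (hY (Finset.mem_union_left _ hx)) (h.isClique hu hx hne)
  refine Finset.union_subset hUD fun w hw => ?_
  obtain ⟨x, hx, hwx⟩ : ∃ x ∈ U, G.Adj w x := by
    by_contra! hnot
    have := h.card_inter_le_one (Finset.mem_union_right _ hw) hnot
    rw [Finset.inter_self] at this
    omega
  exact hD x (hUD hx) w (hY (Finset.mem_union_right _ hw)) hwx.symm

end IsNearClique

lemma IsMatchingOn.exists_subsingleton_of_maximum {M : Finset (V × V)} (hM : IsMatchingOn G Y M)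
    (hmax : ∀ M', IsMatchingOn G Y M' → M'.card ≤ M.card) {p : V × V} (hp : p ∈ M) :
    ∃ w ∈ ({p.1, p.2} : Finset V), {u | u ∈ Y \ covered M ∧ G.Adj w u}.Subsingleton := by
  by_contra! hnot
  obtain ⟨y, hy, hpy⟩ := (hnot p.2 (by simp)).nonempty
  obtain ⟨x, ⟨hx, hpx⟩, hxy⟩ := (hnot p.1 (by simp)).exists_ne y
  obtain ⟨M', hM', hcard⟩ := hM.exists_card_eq_add_one_of_augmenting hp hx hy hxy hpx hpy
  exact absurd (hmax M' hM') (by omega)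

lemma IsMatchingOn.exists_isNearClique {M : Finset (V × V)} (hM : IsMatchingOn Gᶜ Y M)
    (hmax : ∀ M', IsMatchingOn Gᶜ Y M' → M'.card ≤ M.card) :
    ∃ W, IsNearClique G (Y \ covered M) W ∧ W ⊆ Y ∧ W.card = M.card := by
  choose w hwp hw using fun p : M => hM.exists_subsingleton_of_maximum hmax p.2
  have hinj : Function.Injective w := fun p q hpq => Subtype.ext <|
    hM.pairwiseDisjoint.elim_finset p.2 q.2 (w p) (hwp p) (hpq ▸ hwp q)
  have hwM : Finset.univ.image w ⊆ covered M :=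
    Finset.image_subset_iff.2 fun p _ => pair_subset_covered p.2 (hwp p)
  have hdisj : Disjoint (Y \ covered M) (Finset.univ.image w) :=
    Finset.disjoint_of_subset_right hwM Finset.sdiff_disjoint
  refine ⟨Finset.univ.image w, ⟨hdisj, fun x hx y hy hxy => ?_, fun {v} hv => ?_⟩,
    hwM.trans hM.covered_subset, by rw [Finset.card_image_of_injective _ hinj, Finset.card_univ,
      Fintype.card_coe]⟩
  · by_contra hnot
    have hle := hmax _ (hM.insert hx hy ((compl_adj _ _ _).2 ⟨hxy, hnot⟩))
    rw [card_insert_of_notMem_covered (Finset.mem_sdiff.1 hx).2] at hle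
    omega
  · obtain ⟨p, -, rfl⟩ := Finset.mem_image.1 hv
    refine (hw p).anti fun u hu => ⟨hu.1, (compl_adj _ _ _).2 ⟨?_, hu.2⟩⟩
    rintro rfl
    exact Finset.disjoint_left.1 hdisj hu.1 hv

lemma exists_isNearClique_of_not_fanGraph_isContained_compl (hfan : ¬ fanGraph n ⊑ Gᶜ) {v : V}
    (hv : ∀ y ∈ Y, Gᶜ.Adj v y) :
    ∃ U W, IsNearClique G U W ∧ U ∪ W ⊆ Y ∧ U.card + 2 * W.card = Y.card ∧ W.card < n := by
  have hlt (M : Finset (V × V)) (hM : IsMatchingOn Gᶜ Y M) : M.card < n := by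
    by_contra! hle
    obtain ⟨M', hM', rfl⟩ := Finset.exists_subset_card_eq hle
    exact hfan ((hM.mono hM').fanGraph_isContained hv)
  let sizes : Set ℕ := {c | ∃ M, IsMatchingOn Gᶜ Y M ∧ M.card = c}
  have hne : sizes.Nonempty := ⟨0, ∅, ⟨by simp, by simp, by simp⟩, rfl⟩
  have hbdd : BddAbove sizes := ⟨n, by rintro _ ⟨M, hM, rfl⟩; exact (hlt M hM).le⟩
  obtain ⟨M, hM, hmax⟩ := Nat.sSup_mem hne hbdd
  obtain ⟨W, hW, hWY, hWM⟩ :=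
    hM.exists_isNearClique fun M' hM' => hmax ▸ le_csSup hbdd ⟨M', hM', rfl⟩
  refine ⟨_, W, hW, Finset.union_subset Finset.sdiff_subset hWY, ?_, hWM ▸ hlt M hM⟩
  rw [hWM, ← hM.card_covered, Finset.card_sdiff_add_card_eq_card hM.covered_subset]

end NearClique

section Splitting

variable {V : Type*} {G : SimpleGraph V} {k : ℕ} {A B C D : Finset V}
  {𝒞 : Finset (Finset V)}

lemma IsSeparated.symm (h : IsSeparated G A B) : IsSeparated G B A :=
  ⟨h.disjoint.symm, fun ha hb hab => h.not_adj hb ha hab.symm⟩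

lemma IsSeparated.mono (h : IsSeparated G C D) (hA : A ⊆ C) (hB : B ⊆ D) : IsSeparated G A B :=
  ⟨Finset.disjoint_of_subset_left hA (Finset.disjoint_of_subset_right hB h.disjoint),
    fun ha hb => h.not_adj (hA ha) (hB hb)⟩

variable [Fintype V]

/-- A family of nonempty, pairwise separated parts, which miss at most `(#𝒞 - 1) * k` vertices
altogether. -/
structure IsSplitting (G : SimpleGraph V) (k : ℕ) (𝒞 : Finset (Finset V)) : Prop where
  nonempty {C : Finset V} (hC : C ∈ 𝒞) : C.Nonempty
  pairwise_isSeparated : (𝒞 : Set (Finset V)).Pairwise (IsSeparated G)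
  card_le : Fintype.card V + k ≤ ∑ C ∈ 𝒞, C.card + 𝒞.card * k

namespace IsSplitting

lemma pairwiseDisjoint (h : IsSplitting G k 𝒞) : (𝒞 : Set (Finset V)).PairwiseDisjoint id :=
  h.pairwise_isSeparated.imp fun _ _ hCD => hCD.disjoint

lemma card_biUnion [DecidableEq V] (h : IsSplitting G k 𝒞) {𝒟 : Finset (Finset V)} (h𝒟 : 𝒟 ⊆ 𝒞) :
    (𝒟.biUnion id).card = ∑ C ∈ 𝒟, C.card :=
  Finset.card_biUnion (h.pairwiseDisjoint.subset h𝒟)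

lemma degree_le [DecidableEq V] [DecidableRel G.Adj] (h : IsSplitting G k 𝒞) (hC : C ∈ 𝒞)
    {v : V} (hv : v ∈ C) :
    G.degree v ≤ (G.neighborFinset v ∩ C).card + (𝒞.card - 1) * k := by
  have hsub : G.neighborFinset v ⊆ G.neighborFinset v ∩ C ∪ (𝒞.biUnion id)ᶜ := by
    intro w hw
    by_cases hw𝒞 : w ∈ 𝒞.biUnion id
    · obtain ⟨D, hD, hwD⟩ := Finset.mem_biUnion.1 hw𝒞
      obtain rfl : C = D := by
        by_contra hne
        exact (h.pairwise_isSeparated hC hD hne).not_adj hv hwD ((mem_neighborFinset _ _ _).1 hw)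
      exact Finset.mem_union_left _ (Finset.mem_inter.2 ⟨hw, hwD⟩)
    · exact Finset.mem_union_right _ (Finset.mem_compl.2 hw𝒞)
  have hle := (Finset.card_le_card hsub).trans (Finset.card_union_le _ _)
  have hcompl := Finset.card_add_card_compl (𝒞.biUnion id)
  have hcard := h.card_le
  rw [h.card_biUnion subset_rfl] at hcompl
  rw [card_neighborFinset_eq_degree] at hle
  have hk : k ≤ 𝒞.card * k := Nat.le_mul_of_pos_left k (Finset.card_pos.2 ⟨C, hC⟩)
  rw [Nat.sub_one_mul]
  omega

lemma exists_card_eq_add_one (h : IsSplitting G k 𝒞) (hC : C ∈ 𝒞) (hrob : ¬ IsRobustOn G k C) :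
    ∃ 𝒟, IsSplitting G k 𝒟 ∧ 𝒟.card = 𝒞.card + 1 := by
  classical
  simp only [IsRobustOn, not_forall, not_lt] at hrob
  obtain ⟨A, hAC, B, hBC, hA, hB, hAB, hcard⟩ := hrob
  have hsep {E D : Finset V} (hE : E ⊆ C) (hD : D ∈ 𝒞.erase C) : IsSeparated G E D :=
    (h.pairwise_isSeparated hC (Finset.mem_of_mem_erase hD) (Finset.ne_of_mem_erase hD).symm).mono
      hE subset_rfl
  have hnotMem {E : Finset V} (hE : E ⊆ C) (hne : E.Nonempty) : E ∉ 𝒞.erase C := fun hE𝒞 =>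
    hne.ne_empty (Finset.disjoint_self_iff_empty _ |>.1 (hsep hE hE𝒞).disjoint)
  have hA' : A ∉ insert B (𝒞.erase C) := by
    rw [Finset.mem_insert, not_or]
    refine ⟨?_, hnotMem hAC hA⟩
    rintro rfl
    exact hA.ne_empty (Finset.disjoint_self_iff_empty _ |>.1 hAB.disjoint)
  have hcard' : (insert A (insert B (𝒞.erase C))).card = 𝒞.card + 1 := by
    rw [Finset.card_insert_of_notMem hA', Finset.card_insert_of_notMem (hnotMem hBC hB),
      Finset.card_erase_add_one hC]
  refine ⟨_, ⟨?_, ?_, ?_⟩, hcard'⟩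
  · intro D hD
    grind [h.nonempty]
  · have : Std.Symm (IsSeparated G) := ⟨fun _ _ => .symm⟩
    rw [Finset.coe_insert, Finset.coe_insert, Set.pairwise_insert_of_symm,
      Set.pairwise_insert_of_symm]
    refine ⟨⟨h.pairwise_isSeparated.mono (Finset.erase_subset _ _), fun D hD _ => hsep hBC hD⟩,
      fun D hD _ => ?_⟩
    obtain rfl | hD := hD
    · exact hAB
    · exact hsep hAC hD
  · have := h.card_le
    rw [hcard', Finset.sum_insert hA', Finset.sum_insert (hnotMem hBC hB), add_mul]
    rw [← Finset.add_sum_erase _ _ hC] at this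
    omega

end IsSplitting

lemma exists_isSplitting_forall_isRobustOn [Nonempty V] {q : ℕ} (hq : 0 < q)
    (hcard : ∀ 𝒞, IsSplitting G k 𝒞 → 𝒞.card ≠ q + 1) :
    ∃ 𝒞, IsSplitting G k 𝒞 ∧ 𝒞.card ≤ q ∧ ∀ C ∈ 𝒞, IsRobustOn G k C := by
  obtain ⟨𝒞, ⟨h, hle⟩, hmax⟩ := Set.exists_max_image
    {𝒞 : Finset (Finset V) | IsSplitting G k 𝒞 ∧ 𝒞.card ≤ q} Finset.card (Set.toFinite _)
    ⟨{Finset.univ}, ⟨by simp, by simp, by simp⟩, by simpa using Nat.succ_le_of_lt hq⟩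
  refine ⟨𝒞, h, hle, fun C hC => ?_⟩
  by_contra hrob
  obtain ⟨𝒟, h𝒟, h𝒟card⟩ := h.exists_card_eq_add_one hC hrob
  have := hcard 𝒟 h𝒟
  have := hmax 𝒟 ⟨h𝒟, by omega⟩
  omega

end Splitting

section UpperBound

variable {V : Type*} [Fintype V] {G : SimpleGraph V} {k n m : ℕ}
  {C : Finset V} {𝒞 : Finset (Finset V)}

/- The vertices of `C` are adjacent in `Gᶜ` to all other parts, and the near-clique that the
matching structure finds among these cannot meet two of them. -/
lemma IsSplitting.exists_card_add_card_le [DecidableEq V] (h : IsSplitting G k 𝒞)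
    (h𝒞 : 3 ≤ 𝒞.card) (hC : C ∈ 𝒞) (hmin : ∀ D ∈ 𝒞, C.card ≤ D.card) (hfan : ¬ fanGraph n ⊑ Gᶜ)
    (hn : 2 * n ≤ ∑ D ∈ 𝒞.erase C, D.card) :
    ∃ D ∈ 𝒞, C.card + D.card ≤ ∑ D ∈ 𝒞.erase C, D.card ∧
      ∑ D ∈ 𝒞.erase C, D.card < D.card + n := by
  have hY := h.card_biUnion (Finset.erase_subset C 𝒞)
  obtain ⟨v, hv⟩ := h.nonempty hC
  have hvY : ∀ y ∈ (𝒞.erase C).biUnion id, Gᶜ.Adj v y := fun y hy => by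
    obtain ⟨D, hD, hyD⟩ := Finset.mem_biUnion.1 hy
    have hCD := h.pairwise_isSeparated hC (Finset.mem_of_mem_erase hD)
      (Finset.ne_of_mem_erase hD).symm
    exact (compl_adj _ _ _).2 ⟨Finset.disjoint_iff_ne.1 hCD.disjoint v hv y hyD,
      hCD.not_adj hv hyD⟩
  obtain ⟨U, W, hUW, hUWY, hcard, hWn⟩ :=
    exists_isNearClique_of_not_fanGraph_isContained_compl hfan hvY
  have hU : 2 ≤ U.card := by omega
  obtain ⟨u, hu⟩ := Finset.card_pos.1 (show 0 < U.card by omega)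
  obtain ⟨D, hD, huD⟩ := Finset.mem_biUnion.1 (hUWY (Finset.mem_union_left W hu))
  have hD𝒞 := Finset.mem_of_mem_erase hD
  have hclosed : ∀ x ∈ D, ∀ y ∈ (𝒞.erase C).biUnion id, G.Adj x y → y ∈ D := by
    intro x hx y hy hxy
    obtain ⟨E, hE, hyE⟩ := Finset.mem_biUnion.1 hy
    obtain rfl : D = E := by
      by_contra hne
      exact (h.pairwise_isSeparated hD𝒞 (Finset.mem_of_mem_erase hE) hne).not_adj hx hyE hxy
    exact hyE
  have hle := Finset.card_le_card (hUW.union_subset_of_closed hUWY hU hclosed hu huD)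
  rw [Finset.card_union_of_disjoint hUW.disjoint] at hle
  refine ⟨D, hD𝒞, ?_, by omega⟩
  obtain ⟨E, hE⟩ : ((𝒞.erase C).erase D).Nonempty := by
    rw [← Finset.card_pos, Finset.card_erase_of_mem hD, Finset.card_erase_of_mem hC]; omega
  have hEC := hmin E (Finset.mem_of_mem_erase (Finset.mem_of_mem_erase hE))
  rw [← Finset.add_sum_erase _ _ hD, ← Finset.add_sum_erase _ _ hE]
  omega

lemma IsSplitting.fanGraph_isContained_compl (h : IsSplitting G k 𝒞) (h𝒞 : 𝒞.card ≤ 6)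
    (hsmall : ∀ C ∈ 𝒞, C.card ≤ 2 * m + 2 * k) (hk : 0 < k) (hnm : n ≤ 2 * m + 1)
    (hn : 2 * n + 2 * m + 40 * k ≤ Fintype.card V) (hm : 4 * m + 40 * k ≤ Fintype.card V) :
    fanGraph n ⊑ Gᶜ := by
  classical
  by_contra hfan
  have hle := h.card_le
  have h3 : 3 ≤ 𝒞.card := by
    by_contra! hlt
    have hsum : ∑ C ∈ 𝒞, C.card ≤ 2 * (2 * m + 2 * k) :=
      (Finset.sum_le_card_nsmul _ _ _ hsmall).trans (Nat.mul_le_mul_right _ (by omega))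
    have : 𝒞.card * k ≤ 2 * k := Nat.mul_le_mul_right k (by omega)
    omega
  have : 𝒞.card * k ≤ 6 * k := Nat.mul_le_mul_right k h𝒞
  obtain ⟨C, hC, hmin⟩ := 𝒞.exists_min_image Finset.card (Finset.card_pos.1 (by omega))
  have h2C : 2 * C.card ≤ ∑ D ∈ 𝒞.erase C, D.card :=
    (Nat.mul_le_mul_right _ (by rw [Finset.card_erase_of_mem hC]; omega)).trans
      (Finset.card_nsmul_le_sum _ _ _ fun D hD => hmin D (Finset.mem_of_mem_erase hD))
  rw [← Finset.add_sum_erase _ _ hC] at hle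
  obtain ⟨D, hD, hCD, hDn⟩ := h.exists_card_add_card_le h3 hC hmin hfan (by omega)
  have := hsmall D hD
  omega

variable [DecidableRel G.Adj]

lemma le_degree_of_not_fanGraph_isContained_compl [DecidableEq V]
    (hrob : ∀ C : Finset V, 2 * m + 2 * k ≤ C.card →
      (∀ v ∈ C, m + 2 * k ≤ (G.neighborFinset v ∩ C).card) → ¬ IsRobustOn G k C)
    (hfan : ¬ fanGraph n ⊑ Gᶜ) (hk : 0 < k) (hn : 2 * n + 2 * m + 40 * k ≤ Fintype.card V)
    (hm : 4 * m + 40 * k ≤ Fintype.card V) (v : V) : m + 20 * k ≤ G.degree v := by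
  by_contra! hlt
  have hY : (Gᶜ.neighborFinset v).card = Fintype.card V - 1 - G.degree v := by
    rw [card_neighborFinset_eq_degree, degree_compl]
  obtain ⟨U, W, hUW, -, hcard, hWn⟩ := exists_isNearClique_of_not_fanGraph_isContained_compl hfan
    fun (y : V) (hy : y ∈ Gᶜ.neighborFinset v) => (mem_neighborFinset _ _ _).1 hy
  refine hrob (U ∪ W) ?_ (fun w hw => ?_) (hUW.isRobustOn (by omega))
  · rw [Finset.card_union_of_disjoint hUW.disjoint]; omega
  · have := hUW.card_sub_one_le hw
    omega

lemma IsSplitting.le_card_neighborFinset_inter [DecidableEq V] (h : IsSplitting G k 𝒞)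
    (h𝒞 : 𝒞.card ≤ 7) (hC : C ∈ 𝒞) {v : V} (hv : v ∈ C) (hδ : m + 20 * k ≤ G.degree v) :
    m + 14 * k ≤ (G.neighborFinset v ∩ C).card := by
  have hdeg := h.degree_le hC hv
  have : (𝒞.card - 1) * k ≤ 6 * k := Nat.mul_le_mul_right _ (by omega)
  omega

lemma exists_isSplitting_card_le_six (hk : 0 < k) (hδ : ∀ v, m + 20 * k ≤ G.degree v)
    (hV : Fintype.card V ≤ 6 * m + 60 * k) [Nonempty V] :
    ∃ 𝒞, IsSplitting G k 𝒞 ∧ 𝒞.card ≤ 6 ∧ ∀ C ∈ 𝒞, IsRobustOn G k C := by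
  classical
  refine exists_isSplitting_forall_isRobustOn (by omega) fun 𝒞 h h𝒞 => ?_
  have hle : 𝒞.card • (m + 14 * k) ≤ ∑ C ∈ 𝒞, C.card :=
    Finset.card_nsmul_le_sum _ _ _ fun C hC => by
      obtain ⟨v, hv⟩ := h.nonempty hC
      exact (h.le_card_neighborFinset_inter h𝒞.le hC hv (hδ v)).trans
        (Finset.card_le_card Finset.inter_subset_right)
  have hsum := (h.card_biUnion subset_rfl).symm.trans_le (Finset.card_le_univ _)
  rw [h𝒞, smul_eq_mul] at hle
  omega

theorem eventually_cycleGraph_isContained_or_fanGraph_isContained_compl (Q : ℕ) :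
    ∀ᶠ k : ℕ in Filter.atTop, ∀ {V : Type*} [Fintype V] {G : SimpleGraph V} {n m : ℕ}, k ≤ m →
      n ≤ 2 * m + 1 → Fintype.card V ≤ Q * k → Fintype.card V ≤ 6 * m + 60 * k →
      2 * n + 2 * m + 40 * k ≤ Fintype.card V → 4 * m + 40 * k ≤ Fintype.card V →
      cycleGraph (2 * m) ⊑ G ∨ fanGraph n ⊑ Gᶜ := by
  classical
  filter_upwards [eventually_cycleGraph_even_isContained_of_isRobustOn Q,
    Filter.eventually_gt_atTop 0] with k hcycle hk V _ G n m hkm hnm hVQ hV hn hm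
  by_contra hcon
  obtain ⟨hG, hfan⟩ := not_or.1 hcon
  have hrob : ∀ C : Finset V, 2 * m + 2 * k ≤ C.card →
      (∀ v ∈ C, m + 2 * k ≤ (G.neighborFinset v ∩ C).card) → ¬ IsRobustOn G k C :=
    fun C hC hδ hrob => hG (hcycle hkm ((Finset.card_le_univ C).trans hVQ) hC hδ hrob)
  have hδ := le_degree_of_not_fanGraph_isContained_compl hrob hfan hk hn hm
  have : Nonempty V := Fintype.card_pos_iff.1 (by omega)
  obtain ⟨𝒞, h, h𝒞, hrobust⟩ := exists_isSplitting_card_le_six hk hδ hV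
  refine hfan (h.fanGraph_isContained_compl h𝒞 (fun C hC => ?_) hk hnm hn hm)
  by_contra! hlt
  refine hrob C hlt.le (fun v hv => ?_) (hrobust C hC)
  have := h.le_card_neighborFinset_inter (by omega) hC hv (hδ v)
  omega

end UpperBound

section Coloring

variable {V W ι : Type*} [Fintype V] [DecidableEq ι]

lemma not_isContained_compl_comap_top [Fintype W] {F : SimpleGraph W} (hF : F.Connected)
    {f : V → ι} (hf : ∀ i, (Finset.univ.filter fun v => f v = i).card < Fintype.card W) :
    ¬ F ⊑ ((⊤ : SimpleGraph ι).comap f)ᶜ := by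
  rintro ⟨φ⟩
  have hconst (x y : W) : f (φ x) = f (φ y) := by
    obtain ⟨p⟩ := hF.preconnected x y
    induction p with
    | nil => rfl
    | cons h _ ih =>
      refine Eq.trans ?_ ih
      by_contra hne
      exact ((compl_adj _ _ _).1 (φ.toHom.map_adj h)).2 hne
  obtain ⟨w⟩ := hF.nonempty
  refine (hf (f (φ w))).not_ge ?_
  rw [← Finset.card_univ]
  exact Finset.card_le_card_of_injOn φ (by simpa using fun x => hconst x w) φ.injective.injOn

lemma not_fanGraph_isContained_of_coloring {G : SimpleGraph V} (f : G.Coloring (Fin 3)) {n : ℕ}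
    (hf : ∀ v, ∃ j ≠ f v, (Finset.univ.filter fun w => f w = j).card < n) :
    ¬ fanGraph n ⊑ G := by
  rintro ⟨φ⟩
  have hadj {x y : Option (Fin n × Bool)} (hxy : (fanGraph n).Adj x y) : f (φ x) ≠ f (φ y) :=
    f.valid (φ.toHom.map_adj hxy)
  obtain ⟨j, hj, hcard⟩ := hf (φ none)
  have hcolour (i : Fin n) : ∃ b, f (φ (some (i, b))) = j := by
    have h₁ := hadj (show (fanGraph n).Adj none (some (i, false)) from trivial)
    have h₂ := hadj (show (fanGraph n).Adj none (some (i, true)) from trivial)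
    have h₃ := hadj (show (fanGraph n).Adj (some (i, false)) (some (i, true)) from ⟨rfl, by simp⟩)
    by_contra! hne
    have := hne false
    have := hne true
    omega
  choose b hb using hcolour
  refine hcard.not_ge ?_
  conv_lhs => rw [← Fintype.card_fin n, ← Finset.card_univ]
  refine Finset.card_le_card_of_injOn (fun i => φ (some (i, b i))) (by simpa using hb) ?_
  exact fun i _ i' _ hii' => congrArg Prod.fst (Option.some.inj (φ.injective hii'))

lemma exists_forall_card_filter_eq_le [Fintype ι] {s : ι → ℕ} (hs : Fintype.card V ≤ ∑ i, s i) :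
    ∃ f : V → ι, ∀ i, (Finset.univ.filter fun v => f v = i).card ≤ s i := by
  obtain ⟨e⟩ : Nonempty (V ↪ Σ i, Fin (s i)) :=
    Function.Embedding.nonempty_of_card_le (by simpa using hs)
  refine ⟨fun v => (e v).1, fun i => ?_⟩
  have hsub : (Finset.univ.filter fun v => (e v).1 = i).map e ⊆
      Finset.univ.map (Function.Embedding.sigmaMk i) := by
    intro x hx
    obtain ⟨v, hv, rfl⟩ := Finset.mem_map.1 hx
    obtain rfl := (Finset.mem_filter.1 hv).2
    exact Finset.mem_map_of_mem _ (Finset.mem_univ (e v).2)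
  simpa using Finset.card_le_card hsub

end Coloring

section RamseyNumber

variable {V W : Type} {F : SimpleGraph V} {H : SimpleGraph W} {m n N N₀ : ℕ}

lemma ramseyNumber_le (hN : 0 < N) (h : RamseyArrows F H N) : ramseyNumber F H ≤ N :=
  Nat.sInf_le ⟨hN, h⟩

lemma lt_ramseyNumber (hN : 0 < N) (h : RamseyArrows F H N)
    (h₀ : ∀ M ≤ N₀, ¬ RamseyArrows F H M) : N₀ < ramseyNumber F H := by
  by_contra! hle
  have hmem : ramseyNumber F H ∈ {N : ℕ | 0 < N ∧ RamseyArrows F H N} := Nat.sInf_mem ⟨N, hN, h⟩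
  exact h₀ _ hle hmem.2

lemma not_ramseyArrows_fanGraph [Fintype V] (hF : F.Connected) {s : Fin 3 → ℕ}
    (hs : ∀ i, s i < Fintype.card V) (hn : ∀ i, 0 < s i → ∃ j ≠ i, s j < n) (hN : N ≤ ∑ i, s i) :
    ¬ RamseyArrows F (fanGraph n) N := by
  intro h
  obtain ⟨f, hf⟩ := exists_forall_card_filter_eq_le (V := Fin N) ((Fintype.card_fin N).trans_le hN)
  obtain hF' | hfan := h ((⊤ : SimpleGraph (Fin 3)).comap f)ᶜ
  · exact not_isContained_compl_comap_top hF (fun i => (hf i).trans_lt (hs i)) hF'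
  · rw [compl_compl] at hfan
    refine not_fanGraph_isContained_of_coloring (Hom.comap f ⊤) (fun v => ?_) hfan
    have hpos : 0 < s (f v) := (Finset.card_pos.2 ⟨v, by simp⟩).trans_le (hf (f v))
    obtain ⟨j, hj, hjn⟩ := hn (f v) hpos
    exact ⟨j, hj, (hf j).trans_lt hjn⟩

lemma max_le_ramseyNumber_add_four (hm : 0 < m) (hn : 0 < n) (hnm : n ≤ 2 * m + 1) (hN : 0 < N)
    (h : RamseyArrows (cycleGraph (2 * m)) (fanGraph n) N) :
    max (2 * n + 2 * m) (4 * m) ≤ ramseyNumber (cycleGraph (2 * m)) (fanGraph n) + 4 := by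
  have hcycle : (cycleGraph (2 * m)).Connected := by
    obtain ⟨m, rfl⟩ := Nat.exists_eq_add_of_lt hm
    exact cycleGraph_connected
  have hlt (s : Fin 3 → ℕ) (hs : ∀ i, s i < 2 * m) (hsn : ∀ i, 0 < s i → ∃ j ≠ i, s j < n) :
      ∑ i, s i < ramseyNumber (cycleGraph (2 * m)) (fanGraph n) :=
    lt_ramseyNumber hN h fun M hM =>
      not_ramseyArrows_fanGraph hcycle (by simpa using hs) hsn hM
  refine max_le ?_ ?_
  · let r := min (n - 1) (2 * m - 1)
    have hr : r < n := by omega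
    have := hlt ![2 * m - 1, r, r] (fun i => by fin_cases i <;> simp <;> omega)
      (by simp [Fin.forall_fin_succ, Fin.exists_fin_succ, hr])
    simp only [Fin.sum_univ_three, Matrix.cons_val] at this
    omega
  · have := hlt ![2 * m - 1, 2 * m - 1, 0] (fun i => by fin_cases i <;> simp <;> omega)
      (by simp [Fin.forall_fin_succ, Fin.exists_fin_succ, hn])
    simp only [Fin.sum_univ_three, Matrix.cons_val] at this
    omega

end RamseyNumber

section Asymptotics

open Filter Asymptotics

lemma eventually_ramseyNumber_bounds (Q : ℕ) :
    ∀ᶠ k : ℕ in atTop, ∀ {n m : ℕ}, 0 < n → k ≤ m → n ≤ 2 * m + 1 →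
      max (2 * n + 2 * m) (4 * m) + 40 * k ≤ Q * k →
      ramseyNumber (cycleGraph (2 * m)) (fanGraph n) ≤ max (2 * n + 2 * m) (4 * m) + 40 * k ∧
      max (2 * n + 2 * m) (4 * m) ≤ ramseyNumber (cycleGraph (2 * m)) (fanGraph n) + 4 := by
  filter_upwards [eventually_cycleGraph_isContained_or_fanGraph_isContained_compl Q,
    eventually_gt_atTop 0] with k hk hk₀ n m hn hkm hnm hQ
  have harrows : RamseyArrows (cycleGraph (2 * m)) (fanGraph n)
      (max (2 * n + 2 * m) (4 * m) + 40 * k) := fun R => by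
    refine hk hkm hnm ?_ ?_ ?_ ?_ <;> rw [Fintype.card_fin] <;> omega
  exact ⟨ramseyNumber_le (by omega) harrows,
    max_le_ramseyNumber_add_four (by omega) hn hnm (by omega) harrows⟩

variable {a η : ℝ}

lemma abs_max_floor_sub_le (ha : 0 ≤ a) (n : ℕ) :
    |max (2 * n + 2 * ⌊a * n⌋₊ : ℝ) (4 * ⌊a * n⌋₊) - max (2 + 2 * a) (4 * a) * n| ≤ 4 := by
  have hle : (⌊a * n⌋₊ : ℝ) ≤ a * n := Nat.floor_le (by positivity)
  have hlt : a * n < ⌊a * n⌋₊ + 1 := Nat.lt_floor_add_one _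
  rw [max_mul_of_nonneg _ _ n.cast_nonneg]
  refine (abs_max_sub_max_le_max _ _ _ _).trans (max_le ?_ ?_) <;> rw [abs_le] <;>
    constructor <;> linarith

lemma exists_eventually_max_floor_add_le_mul_floor (ha : 0 ≤ a) (hη : 0 < η) :
    ∃ Q : ℕ, ∀ᶠ n : ℕ in atTop,
      max (2 * n + 2 * ⌊a * n⌋₊) (4 * ⌊a * n⌋₊) + 40 * ⌊η * n⌋₊ ≤ Q * ⌊η * n⌋₊ := by
  set t := max (2 + 2 * a) (4 * a)
  obtain ⟨Q, hQ⟩ := exists_nat_ge (2 * (t + 4) / η)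
  refine ⟨Q + 40, ?_⟩
  filter_upwards [eventually_ge_atTop 1, (tendsto_nat_floor_mul_atTop η hη).eventually_ge_atTop 1]
    with n hn hk
  have hmax := (abs_le.1 (abs_max_floor_sub_le ha n)).2
  have hn' : (1 : ℝ) ≤ n := by exact_mod_cast hn
  have hk' : (1 : ℝ) ≤ ⌊η * n⌋₊ := by exact_mod_cast hk
  have hηn : η * n ≤ 2 * ⌊η * n⌋₊ := by
    have := Nat.lt_floor_add_one (η * n)
    linarith
  have hle : max (2 * n + 2 * ⌊a * n⌋₊ : ℝ) (4 * ⌊a * n⌋₊) ≤ Q * ⌊η * n⌋₊ := by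
    calc max (2 * n + 2 * ⌊a * n⌋₊ : ℝ) (4 * ⌊a * n⌋₊) ≤ t * n + 4 := by linarith
      _ ≤ (t + 4) * n := by linarith
      _ = 2 * (t + 4) / η * (η * n) / 2 := by field_simp
      _ ≤ Q * (2 * ⌊η * n⌋₊) / 2 := by gcongr
      _ = Q * ⌊η * n⌋₊ := by ring
  rw [add_mul]
  gcongr
  exact_mod_cast hle

lemma eventually_abs_ramseyNumber_sub_le (ha : 1 / 2 ≤ a) (hη : 0 < η) (hηa : η ≤ 1 / 4) :
    ∀ᶠ n : ℕ in atTop, |(ramseyNumber (cycleGraph (2 * ⌊a * n⌋₊)) (fanGraph n) : ℝ) -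
      max (2 + 2 * a) (4 * a) * n| ≤ 40 * η * n + 8 := by
  have ha₀ : 0 ≤ a := by linarith
  obtain ⟨Q, hQ⟩ := exists_eventually_max_floor_add_le_mul_floor ha₀ hη
  have hbounds := (tendsto_nat_floor_mul_atTop η hη).eventually (eventually_ramseyNumber_bounds Q)
  filter_upwards [hQ, hbounds, eventually_gt_atTop 0] with n hQn hn hpos
  have hkm : ⌊η * n⌋₊ ≤ ⌊a * n⌋₊ := by gcongr; linarith
  have hnm : n ≤ 2 * ⌊a * n⌋₊ + 1 := by
    have hlt := Nat.lt_floor_add_one (a * n)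
    have hhalf : 1 / 2 * (n : ℝ) ≤ a * n := by gcongr
    have : (n : ℝ) < 2 * ⌊a * n⌋₊ + 2 := by linarith
    exact Nat.le_of_lt_succ (by exact_mod_cast this)
  obtain ⟨hle, hge⟩ := hn hpos hkm hnm hQn
  rify at hle hge
  have hmax := abs_le.1 (abs_max_floor_sub_le ha₀ n)
  have hk : (⌊η * n⌋₊ : ℝ) ≤ η * n := Nat.floor_le (by positivity)
  rw [abs_le]
  constructor <;> nlinarith

theorem isLittleO_ramseyNumber_sub (ha : 1 / 2 ≤ a) :
    (fun n : ℕ => (ramseyNumber (cycleGraph (2 * ⌊a * n⌋₊)) (fanGraph n) : ℝ) -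
      max (2 + 2 * a) (4 * a) * n) =o[atTop] fun n : ℕ => (n : ℝ) := by
  refine isLittleO_iff.2 fun c hc => ?_
  have hη : 0 < min (1 / 4) (c / 80) := by positivity
  filter_upwards [eventually_abs_ramseyNumber_sub_le ha hη (min_le_left _ _),
    tendsto_natCast_atTop_atTop.eventually_ge_atTop (16 / c)] with n hn hcn
  rw [div_le_iff₀ hc] at hcn
  rw [Real.norm_eq_abs, Real.norm_natCast]
  have hηn : min (1 / 4) (c / 80) * n ≤ c / 80 * n := by
    gcongr
    exact min_le_right _ _
  linarith

end Asymptotics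

theorem theorem1 (a : ℝ) (ha : 1 / 2 ≤ a) :
    (a < 1 → ∃ ε : ℕ → ℝ, Filter.Tendsto ε Filter.atTop (nhds 0) ∧
      ∀ᶠ n : ℕ in Filter.atTop,
        (ramseyNumber (SimpleGraph.cycleGraph (2 * ⌊a * (n : ℝ)⌋₊)) (fanGraph n) : ℝ)
          = (2 + 2 * a + ε n) * n) ∧
    (1 ≤ a → ∃ ε : ℕ → ℝ, Filter.Tendsto ε Filter.atTop (nhds 0) ∧
      ∀ᶠ n : ℕ in Filter.atTop,
        (ramseyNumber (SimpleGraph.cycleGraph (2 * ⌊a * (n : ℝ)⌋₊)) (fanGraph n) : ℝ)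
          = (4 * a + ε n) * n) := by
  obtain ⟨ε, hε, heq⟩ := Asymptotics.isLittleO_iff_exists_eq_mul.1 (isLittleO_ramseyNumber_sub ha)
  have hmax : ∀ᶠ n : ℕ in Filter.atTop,
      (ramseyNumber (SimpleGraph.cycleGraph (2 * ⌊a * (n : ℝ)⌋₊)) (fanGraph n) : ℝ) =
        (max (2 + 2 * a) (4 * a) + ε n) * n := by
    filter_upwards [heq] with n hn
    rw [add_mul]
    exact sub_eq_iff_eq_add'.1 hn
  refine ⟨fun ha₁ => ⟨ε, hε, ?_⟩, fun ha₁ => ⟨ε, hε, ?_⟩⟩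
  · rwa [max_eq_left (by linarith)] at hmax
  · rwa [max_eq_right (by linarith)] at hmax
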